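/- Let $1\le r\le\infty$ and let $\mathcal O$ be a compact $n$-dimensional orbifold of class $C^{r+1}$ (with $\infty+1=\infty$): a compact Hausdorff space $X$ with a family of charts $(\tilde U_i,\Gamma_i,\pi_i)$, where $\tilde U_i\subset\mathbb R^n$ is open, homeomorphic to $\mathbb R^n$ and contains $0$, $\Gamma_i$ is a finite group acting effectively on $\tilde U_i$ by $C^{r+1}$ diffeomorphisms that fix $0$, and $\pi_i:\tilde U_i\to X$ induces a homeomorphism of $\tilde U_i/\Gamma_i$ onto an open set $U_i\subset X$; every point $x\in X$ has arbitrarily small chart neighborhoods $U_i$ with $\pi_i(0)=x$; and whenever $U_i\subset U_j$ there are a $C^{r+1}$ embedding $\psi:\tilde U_i\to\tilde U_j$ with $\pi_j\circ\psi=\pi_i$ and an injective homomorphism $\theta:\Gamma_i\to\Gamma_j$ for which $\psi$ is equivariant. The tangent orbibundle $p:T\mathcal O\to X$ is obtained by gluing the products $\tilde U_i\times\mathbb R^n$ along the differentials of the $C^{r+1}$ diffeomorphisms between open subsets of the $\tilde U_i$ that lie over the identity of $X$; over $U_i$ its chart is $\tilde U_i\times\mathbb R^n$ with the action $\gamma\cdot(\tilde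 y,\tilde v)=(\gamma\tilde y,d\gamma_{\tilde y}\tilde v)$. A $C^r$ orbisection is a continuous map $\sigma:X\to T\mathcal O$ with $p\circ\sigma=\mathrm{id}$ that has over every chart $\tilde U_i$ an equivariant $C^r$ lift $\tilde U_i\to\tilde U_i\times\mathbb R^n$ of the form $\tilde y\mapsto(\tilde y,\tilde s_i(\tilde y))$. The $\tilde s_i$ are unique, and the set $\mathscr D^r_{\mathrm{Orb}}(\mathcal O)$ of $C^r$ orbisections is a real vector space under the pointwise operations on the $\tilde s_i$. Let $\mathcal C=\{C_a\}$ be a finite cover of $X$ by open sets with $\overline{C_a}$ compact and contained in $U_{i_a}$ for a chart $i_a$. The $C^r$ topology on $\mathscr D^r_{\mathrm{Orb}}(\mathcal O)$ (relative to $\mathcal C$) is the one in which the sets $\mathscr N^s(\sigma,\varepsilon)$, for $\varepsilon>0$ and finite $s\le r$, are the basic neighborhoods of $\sigma$; $\mathscr N^s(\sigma,\varepsilon)$ consists of all orbisections $\tau$ such that, for every $a$ and every $m\le s$, the $m$-th derivatives of the lifts of $\sigma$ and $\tau$ over $\tilde U_{i_a}$ differ by less than $\varepsilon$ at every point of $\pi_{i_a}^{-1}(C_a)$.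 Then, for every such cover $\mathcal C$, $\mathscr D^r_{\mathrm{Orb}}(\mathcal O)$ with the $C^r$ topology is a separable Banach space (its topology is given by a complete norm) if $r<\infty$, and a separable Fréchet space if $r=\infty$. Moreover it is realized as a closed subspace of a finite direct sum of spaces $C^r(\bar B,\mathbb R^n)$: there are finitely many charts $i_1,\dots,i_N$ and closed balls $\bar B_a=\bar B(0,\rho_a)\subset\tilde U_{i_a}$, $\rho_a>0$, such that the sets $\pi_{i_a}(B(0,\rho_a))$ cover $X$ and the linear map $$\mathscr D^r_{\mathrm{Orb}}(\mathcal O)\to\bigoplus_{a=1}^N C^r(\bar B_a,\mathbb R^n),\qquad \sigma\mapsto\bigl(\tilde s_{i_a}|_{\bar B_a}\bigr)_a$$ is a homeomorphism onto a closed subspace. Here $C^r(\bar B_a,\mathbb R^n)$ carries the topology of uniform convergence of all derivatives of order $\le r$ (of every finite order if $r=\infty$). -/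

import Mathlib

open Set Filter Topology

universe u v

/-- The data of a local uniformization of a space `X`: a set `source` of `E`, a group `Γ` acting
on it through the maps `act γ`, and a projection `proj` to `X`. Only the values of `act γ` and
`proj` on `source` matter. -/
structure OrbifoldChart (E : Type*) (X : Type*) where
  source : Set E
  Γ : Type
  [group : Group Γ]
  act : Γ → E → E
  proj : E → X

attribute [instance] OrbifoldChart.group

namespace OrbifoldChart

/-- The open set of `X` covered by a chart. -/
def image {E X : Type*} (c : OrbifoldChart E X) : Set X := c.proj '' c.source

/-- `c` is a `C^k` orbifold chart about the point `c.proj 0`: its source is open and homeomorphic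
to the model space, its finite group acts effectively on the source by `C^k` diffeomorphisms
that fix the origin, and `c.proj` induces a homeomorphism of the orbit space onto an open set. -/
structure IsSmooth (k : ℕ∞) {E X : Type*} [NormedAddCommGroup E] [NormedSpace ℝ E]
    [TopologicalSpace X] (c : OrbifoldChart E X) : Prop where
  finite : Finite c.Γ
  isOpen_source : IsOpen c.source
  homeo : Nonempty (c.source ≃ₜ E)
  zero_mem : (0 : E) ∈ c.source
  act_mem : ∀ γ, ∀ y ∈ c.source, c.act γ y ∈ c.source
  act_one : ∀ y ∈ c.source, c.act 1 y = y
  act_mul : ∀ γ δ, ∀ y ∈ c.source, c.act (γ * δ) y = c.act γ (c.act δ y)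
  act_zero : ∀ γ, c.act γ 0 = 0
  effective : ∀ γ, (∀ y ∈ c.source, c.act γ y = y) → γ = 1
  contDiffOn_act : ∀ γ, ContDiffOn ℝ k (c.act γ) c.source
  continuousOn_proj : ContinuousOn c.proj c.source
  isOpen_proj_image : ∀ V ⊆ c.source, IsOpen V → IsOpen (c.proj '' V)
  proj_eq_iff : ∀ y ∈ c.source, ∀ z ∈ c.source, c.proj y = c.proj z ↔ ∃ γ, c.act γ y = z

/-- A `C^k` embedding `ψ` of the chart `c` in the chart `d` that lies over the identity of `X`
and is equivariant with respect to the injective homomorphism `θ`. -/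
structure IsEmbedding (k : ℕ∞) {E X : Type*} [NormedAddCommGroup E] [NormedSpace ℝ E]
    (c d : OrbifoldChart E X) (ψ : E → E) (θ : c.Γ →* d.Γ) : Prop where
  mapsTo : MapsTo ψ c.source d.source
  injOn : InjOn ψ c.source
  contDiffOn : ContDiffOn ℝ k ψ c.source
  injective_fderiv : ∀ y ∈ c.source, Function.Injective (fderiv ℝ ψ y)
  injective_hom : Function.Injective θ
  equivariant : ∀ γ, ∀ y ∈ c.source, ψ (c.act γ y) = d.act (θ γ) (ψ y)
  proj_eq : ∀ y ∈ c.source, d.proj (ψ y) = c.proj y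

/-- `F` is a `C^r` lift of `f : X → Y` over the chart `c` to the chart `d`, equivariant with
respect to some homomorphism of the groups. -/
structure IsLift (r : ℕ∞) {E X E' Y : Type*} [NormedAddCommGroup E] [NormedSpace ℝ E]
    [NormedAddCommGroup E'] [NormedSpace ℝ E'] (c : OrbifoldChart E X) (d : OrbifoldChart E' Y)
    (f : X → Y) (F : E → E') : Prop where
  contDiffOn : ContDiffOn ℝ r F c.source
  mapsTo : MapsTo F c.source d.source
  proj_eq : ∀ y ∈ c.source, d.proj (F y) = f (c.proj y)
  exists_hom : ∃ Θ : c.Γ →* d.Γ, ∀ γ, ∀ y ∈ c.source, F (c.act γ y) = d.act (Θ γ) (F y)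

end OrbifoldChart

/-- A `C^k` orbifold structure of dimension `n` on the space `X`. -/
structure Orbifold (n : ℕ) (k : ℕ∞) (X : Type u) [TopologicalSpace X] where
  ι : Type v
  chart : ι → OrbifoldChart (EuclideanSpace ℝ (Fin n)) X
  isSmooth : ∀ i, (chart i).IsSmooth k
  exists_chart : ∀ x, ∀ U ∈ 𝓝 x, ∃ i, (chart i).proj 0 = x ∧ (chart i).image ⊆ U
  exists_embedding : ∀ i j, (chart i).image ⊆ (chart j).image →
    ∃ ψ θ, OrbifoldChart.IsEmbedding k (chart i) (chart j) ψ θ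

namespace OrbifoldChart.IsSmooth

variable {k : ℕ∞} {E X : Type*} [NormedAddCommGroup E] [NormedSpace ℝ E]
  [TopologicalSpace X] {c : OrbifoldChart E X}

theorem isPreconnected (h : c.IsSmooth k) : IsPreconnected c.source := by
  obtain ⟨e⟩ := h.homeo
  have : PreconnectedSpace c.source :=
    e.symm.surjective.denseRange.preconnectedSpace e.symm.continuous
  exact isPreconnected_iff_preconnectedSpace.2 this

theorem continuousOn_act (h : c.IsSmooth k) (γ : c.Γ) : ContinuousOn (c.act γ) c.source :=
  (h.contDiffOn_act γ).continuousOn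

theorem act_inv_act (h : c.IsSmooth k) (γ : c.Γ) {y : E} (hy : y ∈ c.source) :
    c.act γ⁻¹ (c.act γ y) = y := by
  rw [← h.act_mul _ _ _ hy, inv_mul_cancel, h.act_one _ hy]

theorem act_pow_of_fixed (h : c.IsSmooth k) (γ : c.Γ) {y : E} (hy : y ∈ c.source)
    (hf : c.act γ y = y) (m : ℕ) : c.act (γ ^ m) y = y := by
  induction m with
  | zero => simpa using h.act_one _ hy
  | succ m ih => rw [pow_succ, h.act_mul _ _ _ hy, hf, ih]

theorem hasStrictFDerivAt_id (h : c.IsSmooth k) (hk : 1 ≤ k) (γ : c.Γ) {W : Set E}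
    (hW : IsOpen W) (hfix : ∀ y ∈ W, c.act γ y = y) {y : E}
    (hy : y ∈ c.source) (hyW : y ∈ closure W) :
    HasStrictFDerivAt (c.act γ) (ContinuousLinearMap.id ℝ E) y := by
  have hk' : (1 : WithTop ℕ∞) ≤ (k : WithTop ℕ∞) := by exact_mod_cast hk
  have hcd : ContDiffAt ℝ k (c.act γ) y :=
    (h.contDiffOn_act γ).contDiffAt (h.isOpen_source.mem_nhds hy)
  have hs := hcd.hasStrictFDerivAt (by intro h0; rw [h0] at hk'; simp at hk')
  have hcont : ContinuousOn (fderiv ℝ (c.act γ)) c.source :=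
    (h.contDiffOn_act γ).continuousOn_fderiv_of_isOpen h.isOpen_source hk'
  have hid : ∀ z ∈ W, fderiv ℝ (c.act γ) z = ContinuousLinearMap.id ℝ E := by
    intro z hz
    have : c.act γ =ᶠ[𝓝 z] id := by
      filter_upwards [hW.mem_nhds hz] with w hw using hfix w hw
    rw [this.fderiv_eq, fderiv_id]
  have : fderiv ℝ (c.act γ) y = ContinuousLinearMap.id ℝ E := by
    have hcl : y ∈ closure W := hyW
    have h1 : Tendsto (fderiv ℝ (c.act γ)) (𝓝[W] y) (𝓝 (fderiv ℝ (c.act γ) y)) :=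
      ((hcont.continuousAt (h.isOpen_source.mem_nhds hy)).tendsto).mono_left nhdsWithin_le_nhds
    have h2 : Tendsto (fderiv ℝ (c.act γ)) (𝓝[W] y) (𝓝 (ContinuousLinearMap.id ℝ E)) :=
      tendsto_const_nhds.congr' (by
        filter_upwards [self_mem_nhdsWithin] with z hz using (hid z hz).symm)
    have : (𝓝[W] y).NeBot := mem_closure_iff_nhdsWithin_neBot.1 hcl
    exact tendsto_nhds_unique h1 h2
  rwa [this] at hs

/-- A group element that is the identity on a nonempty open set is the unit. -/
theorem eq_one_of_fixed [CompleteSpace E] (h : c.IsSmooth k) (hk : 1 ≤ k) (γ : c.Γ) {V : Set E}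
    (hV : IsOpen V) (hVs : V ⊆ c.source) (hne : V.Nonempty) (hfix : ∀ y ∈ V, c.act γ y = y) :
    γ = 1 := by
  have := h.finite
  apply h.effective
  set W : Set E := interior {y | y ∈ c.source ∧ c.act γ y = y} with hWdef
  have hWs : W ⊆ c.source := fun y hy => (interior_subset hy).1
  have hWf : ∀ y ∈ W, c.act γ y = y := fun y hy => (interior_subset hy).2
  have key : c.source ⊆ W := by
    refine h.isPreconnected.subset_of_closure_inter_subset isOpen_interior ?_ ?_
    · obtain ⟨y, hy⟩ := hne
      exact ⟨y, hVs hy, mem_interior.2 ⟨V, fun z hz => ⟨hVs hz, hfix z hz⟩, hV, hy⟩⟩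
    · rintro y ⟨hyW, hys⟩
      set m := orderOf γ with hm
      have hmpos : 0 < m := orderOf_pos γ
      have hd : ∀ j : ℕ, HasStrictFDerivAt (c.act (γ ^ j)) (ContinuousLinearMap.id ℝ E) y :=
        fun j => h.hasStrictFDerivAt_id hk _ isOpen_interior
          (fun z hz => h.act_pow_of_fixed γ (hWs hz) (hWf z hz) j) hys hyW
      set F : E → E := fun z => (m : ℝ)⁻¹ • ∑ j ∈ Finset.range m, c.act (γ ^ j) z with hF
      have hFd : HasStrictFDerivAt F
          ((ContinuousLinearEquiv.refl ℝ E : E ≃L[ℝ] E) : E →L[ℝ] E) y := by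
        have h1 := (HasStrictFDerivAt.fun_sum (u := Finset.range m)
          (fun j _ => hd j)).const_smul ((m : ℝ)⁻¹)
        have h2 : ((ContinuousLinearEquiv.refl ℝ E : E ≃L[ℝ] E) : E →L[ℝ] E) =
            (m : ℝ)⁻¹ • ∑ _j ∈ Finset.range m, ContinuousLinearMap.id ℝ E := by
          have hm0 : (m : ℝ) ≠ 0 := Nat.cast_ne_zero.2 hmpos.ne'
          rw [Finset.sum_const, Finset.card_range, ← Nat.cast_smul_eq_nsmul ℝ, smul_smul,
            inv_mul_cancel₀ hm0, one_smul]
          rfl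
        rw [h2]
        exact h1
      have hcomm : ∀ z ∈ c.source, F (c.act γ z) = F z := by
        intro z hz
        have : ∀ j, c.act (γ ^ j) (c.act γ z) = c.act (γ ^ (j + 1)) z := fun j => by
          rw [pow_succ, h.act_mul _ _ _ hz]
        simp only [hF, this]
        congr 1
        have h1 := Finset.sum_range_succ (fun j => c.act (γ ^ j) z) m
        have h2 := Finset.sum_range_succ' (fun j => c.act (γ ^ j) z) m
        rw [h1] at h2
        simp only [hm, pow_orderOf_eq_one, pow_zero] at h2
        exact (add_right_cancel h2).symm
      set e := hFd.toOpenPartialHomeomorph F with he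
      have hye : y ∈ e.source := hFd.mem_toOpenPartialHomeomorph_source
      have hgy : c.act γ y = y := by
        have h1 : Tendsto (c.act γ) (𝓝[W] y) (𝓝 (c.act γ y)) :=
          (((h.continuousOn_act γ).continuousAt (h.isOpen_source.mem_nhds hys)).tendsto).mono_left
            nhdsWithin_le_nhds
        have h2 : Tendsto (c.act γ) (𝓝[W] y) (𝓝 y) := by
          have : Tendsto (fun z : E => z) (𝓝[W] y) (𝓝 y) :=
            tendsto_id.mono_left nhdsWithin_le_nhds
          refine this.congr' ?_
          filter_upwards [self_mem_nhdsWithin] with z hz using (hWf z hz).symm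
        have : (𝓝[W] y).NeBot := mem_closure_iff_nhdsWithin_neBot.1 hyW
        exact tendsto_nhds_unique h1 h2
      have hev : ∀ᶠ z in 𝓝 y, z ∈ c.source ∧ c.act γ z = z := by
        have hc : ContinuousAt (c.act γ) y :=
          (h.continuousOn_act γ).continuousAt (h.isOpen_source.mem_nhds hys)
        have h1 : ∀ᶠ z in 𝓝 y, c.act γ z ∈ e.source := by
          apply hc.eventually_mem
          rw [hgy]
          exact e.open_source.mem_nhds hye
        filter_upwards [h1, e.open_source.mem_nhds hye, h.isOpen_source.mem_nhds hys]
          with z hz1 hz2 hz3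
        exact ⟨hz3, e.injOn hz1 hz2 (hcomm z hz3)⟩
      exact mem_interior_iff_mem_nhds.2 hev
  exact fun y hy => hWf y (key hy)

/-- Points with trivial stabilizer are dense. -/
theorem exists_regular [CompleteSpace E] (h : c.IsSmooth k) (hk : 1 ≤ k) {V : Set E}
    (hV : IsOpen V) (hVs : V ⊆ c.source) (hne : V.Nonempty) :
    ∃ y ∈ V, ∀ γ, c.act γ y = y → γ = 1 := by
  classical
  have := h.finite
  have := Fintype.ofFinite c.Γ
  suffices H : ∀ s : Finset c.Γ, ∃ V' ⊆ V, IsOpen V' ∧ V'.Nonempty ∧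
      ∀ γ ∈ s, γ ≠ 1 → ∀ y ∈ V', c.act γ y ≠ y by
    obtain ⟨V', hV', -, ⟨y, hy⟩, H'⟩ := H Finset.univ
    exact ⟨y, hV' hy, fun γ hγ => by_contra fun h1 => H' γ (Finset.mem_univ _) h1 y hy hγ⟩
  intro s
  induction s using Finset.induction_on with
  | empty => exact ⟨V, Subset.rfl, hV, hne, by simp⟩
  | insert δ s _ ih =>
    obtain ⟨V', hV', ho, hn, H⟩ := ih
    by_cases hδ : δ = 1
    · refine ⟨V', hV', ho, hn, ?_⟩
      intro γ hγ h1
      rcases Finset.mem_insert.1 hγ with rfl | h2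
      · exact absurd hδ h1
      · exact H γ h2 h1
    · have : ∃ y ∈ V', c.act δ y ≠ y := by
        by_contra! hcon
        exact hδ (h.eq_one_of_fixed hk δ ho (hV'.trans hVs) hn hcon)
      obtain ⟨y, hy, hyne⟩ := this
      refine ⟨V' ∩ {z | c.act δ z ≠ z}, inter_subset_left.trans hV', ?_, ⟨y, hy, hyne⟩, ?_⟩
      · rw [isOpen_iff_mem_nhds]
        rintro z ⟨hz, hzne⟩
        have hc : ContinuousAt (c.act δ) z :=
          (h.continuousOn_act δ).continuousAt (h.isOpen_source.mem_nhds (hVs (hV' hz)))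
        exact inter_mem (ho.mem_nhds hz) ((hc.ne_iff_eventually_ne continuousAt_id).1 hzne)
      · intro γ hγ h1 z hz
        rcases Finset.mem_insert.1 hγ with rfl | h2
        · exact hz.2
        · exact H γ h2 h1 z hz.1

end OrbifoldChart.IsSmooth

namespace Orbifold

variable {n : ℕ} {k r : ℕ∞} {X : Type u} [TopologicalSpace X]

/-- A `C^k` diffeomorphism between open subsets of the sources of two charts that lies over the
identity of `X`: a local change of uniformizing coordinates. -/
structure IsTransition (O : Orbifold.{u, v} n k X) (i j : O.ι)
    (ψ : OpenPartialHomeomorph (EuclideanSpace ℝ (Fin n)) (EuclideanSpace ℝ (Fin n))) : Prop where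
  source_subset : ψ.source ⊆ (O.chart i).source
  target_subset : ψ.target ⊆ (O.chart j).source
  contDiffOn : ContDiffOn ℝ k ψ ψ.source
  contDiffOn_symm : ContDiffOn ℝ k ψ.symm ψ.target
  proj_eq : ∀ y ∈ ψ.source, (O.chart j).proj (ψ y) = (O.chart i).proj y

namespace IsTransition

variable {O : Orbifold.{u, v} n k X} {i j l : O.ι}
  {ψ φ : OpenPartialHomeomorph (EuclideanSpace ℝ (Fin n)) (EuclideanSpace ℝ (Fin n))}

theorem refl (O : Orbifold.{u, v} n k X) (i : O.ι) :
    O.IsTransition i i (OpenPartialHomeomorph.ofSet _ (O.isSmooth i).isOpen_source) where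
  source_subset := by simp
  target_subset := by simp
  contDiffOn := by simpa using contDiffOn_id
  contDiffOn_symm := by simpa using contDiffOn_id
  proj_eq := by simp

theorem symm (h : O.IsTransition i j ψ) : O.IsTransition j i ψ.symm where
  source_subset := by simpa using h.target_subset
  target_subset := by simpa using h.source_subset
  contDiffOn := by simpa using h.contDiffOn_symm
  contDiffOn_symm := by simpa using h.contDiffOn
  proj_eq := by
    intro y hy
    have hy' : y ∈ ψ.target := by simpa using hy
    rw [← h.proj_eq _ (ψ.map_target hy'), ψ.right_inv hy']

theorem trans (h : O.IsTransition i j ψ) (h' : O.IsTransition j l φ) :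
    O.IsTransition i l (ψ.trans φ) where
  source_subset := by
    rw [OpenPartialHomeomorph.trans_source]
    exact inter_subset_left.trans h.source_subset
  target_subset := by
    rw [OpenPartialHomeomorph.trans_target]
    exact inter_subset_left.trans h'.target_subset
  contDiffOn := by
    rw [OpenPartialHomeomorph.trans_source, OpenPartialHomeomorph.coe_trans]
    exact h'.contDiffOn.comp (h.contDiffOn.mono inter_subset_left) (fun y hy => hy.2)
  contDiffOn_symm := by
    rw [OpenPartialHomeomorph.trans_target, OpenPartialHomeomorph.coe_trans_symm]
    exact h.contDiffOn_symm.comp (h'.contDiffOn_symm.mono inter_subset_left) (fun y hy => hy.2)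
  proj_eq := by
    intro y hy
    rw [OpenPartialHomeomorph.trans_source] at hy
    rw [OpenPartialHomeomorph.coe_trans, Function.comp_apply, h'.proj_eq _ hy.2, h.proj_eq _ hy.1]

theorem differentiableAt (hk : 1 ≤ k) (h : O.IsTransition i j ψ)
    {y : EuclideanSpace ℝ (Fin n)} (hy : y ∈ ψ.source) : DifferentiableAt ℝ ψ y := by
  have hk' : (1 : WithTop ℕ∞) ≤ (k : WithTop ℕ∞) := by exact_mod_cast hk
  exact (h.contDiffOn.contDiffAt (ψ.open_source.mem_nhds hy)).differentiableAt
    (by intro h0; rw [h0] at hk'; simp at hk')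

theorem fderiv_symm_fderiv (hk : 1 ≤ k) (h : O.IsTransition i j ψ)
    {y : EuclideanSpace ℝ (Fin n)} (hy : y ∈ ψ.source) (v : EuclideanSpace ℝ (Fin n)) :
    fderiv ℝ ψ.symm (ψ y) (fderiv ℝ ψ y v) = v := by
  have h1 : HasFDerivAt (ψ.symm ∘ ψ) ((fderiv ℝ ψ.symm (ψ y)).comp (fderiv ℝ ψ y)) y :=
    HasFDerivAt.comp y (h.symm.differentiableAt hk (by simpa using ψ.map_source hy)).hasFDerivAt
      (h.differentiableAt hk hy).hasFDerivAt
  have h2 : ψ.symm ∘ ψ =ᶠ[𝓝 y] id := by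
    filter_upwards [ψ.open_source.mem_nhds hy] with z hz using ψ.left_inv hz
  have h3 : (fderiv ℝ ψ.symm (ψ y)).comp (fderiv ℝ ψ y) =
      ContinuousLinearMap.id ℝ (EuclideanSpace ℝ (Fin n)) :=
    h1.unique ((hasFDerivAt_id y).congr_of_eventuallyEq h2)
  exact congrArg (fun A : EuclideanSpace ℝ (Fin n) →L[ℝ] EuclideanSpace ℝ (Fin n) => A v) h3

theorem fderiv_trans (hk : 1 ≤ k) (h : O.IsTransition i j ψ) (h' : O.IsTransition j l φ)
    {y : EuclideanSpace ℝ (Fin n)} (hy : y ∈ ψ.source) (hy' : ψ y ∈ φ.source)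
    (v : EuclideanSpace ℝ (Fin n)) :
    fderiv ℝ (ψ.trans φ) y v = fderiv ℝ φ (ψ y) (fderiv ℝ ψ y v) := by
  have h1 : HasFDerivAt (φ ∘ ψ) ((fderiv ℝ φ (ψ y)).comp (fderiv ℝ ψ y)) y :=
    HasFDerivAt.comp y (h'.differentiableAt hk hy').hasFDerivAt
      (h.differentiableAt hk hy).hasFDerivAt
  rw [OpenPartialHomeomorph.coe_trans, h1.fderiv]
  rfl

end IsTransition

/-- The action of a group element on the source of a chart, as a change of coordinates. -/
theorem exists_transition_act (O : Orbifold.{u, v} n k X) (i : O.ι) (γ : (O.chart i).Γ) :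
    ∃ ψ, O.IsTransition i i ψ ∧ ψ.source = (O.chart i).source ∧
      ∀ y, ψ y = (O.chart i).act γ y := by
  have h := O.isSmooth i
  refine ⟨{ toFun := (O.chart i).act γ
            invFun := (O.chart i).act γ⁻¹
            source := (O.chart i).source
            target := (O.chart i).source
            map_source' := fun y hy => h.act_mem _ _ hy
            map_target' := fun y hy => h.act_mem _ _ hy
            left_inv' := fun y hy => h.act_inv_act γ hy
            right_inv' := fun y hy => by simpa using h.act_inv_act γ⁻¹ hy
            open_source := h.isOpen_source
            open_target := h.isOpen_source
            continuousOn_toFun := h.continuousOn_act γ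
            continuousOn_invFun := h.continuousOn_act γ⁻¹ }, ?_, rfl, fun _ => rfl⟩
  exact
    { source_subset := Subset.rfl
      target_subset := Subset.rfl
      contDiffOn := h.contDiffOn_act γ
      contDiffOn_symm := h.contDiffOn_act γ⁻¹
      proj_eq := fun y hy => ((h.proj_eq_iff y hy _ (h.act_mem _ _ hy)).2 ⟨γ, rfl⟩).symm }

/-- An embedding of charts is a change of coordinates near every point. -/
theorem exists_transition_embedding (hk : 1 ≤ k) (O : Orbifold.{u, v} n k X) {i j : O.ι}
    {α : EuclideanSpace ℝ (Fin n) → EuclideanSpace ℝ (Fin n)}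
    {θ : (O.chart i).Γ →* (O.chart j).Γ}
    (hα : OrbifoldChart.IsEmbedding k (O.chart i) (O.chart j) α θ)
    {y : EuclideanSpace ℝ (Fin n)} (hy : y ∈ (O.chart i).source) :
    ∃ ψ, O.IsTransition i j ψ ∧ y ∈ ψ.source ∧ ∀ z, ψ z = α z := by
  have h := O.isSmooth i
  have hk' : (1 : WithTop ℕ∞) ≤ (k : WithTop ℕ∞) := by exact_mod_cast hk
  have hk0 : (k : WithTop ℕ∞) ≠ 0 := by intro h0; rw [h0] at hk'; simp at hk'
  have hcd : ∀ z ∈ (O.chart i).source, ContDiffAt ℝ k α z := fun z hz =>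
    hα.contDiffOn.contDiffAt (h.isOpen_source.mem_nhds hz)
  have heq : ∀ z ∈ (O.chart i).source,
      ∃ A : EuclideanSpace ℝ (Fin n) ≃L[ℝ] EuclideanSpace ℝ (Fin n), HasFDerivAt α
        (A : EuclideanSpace ℝ (Fin n) →L[ℝ] EuclideanSpace ℝ (Fin n)) z := by
    intro z hz
    let A : EuclideanSpace ℝ (Fin n) ≃L[ℝ] EuclideanSpace ℝ (Fin n) :=
      (LinearEquiv.ofInjectiveEndo (fderiv ℝ α z).toLinearMap
        (hα.injective_fderiv z hz)).toContinuousLinearEquiv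
    have hA : (A : EuclideanSpace ℝ (Fin n) →L[ℝ] EuclideanSpace ℝ (Fin n)) = fderiv ℝ α z :=
      ContinuousLinearMap.ext fun w => rfl
    refine ⟨A, ?_⟩
    rw [hA]
    exact ((hcd z hz).differentiableAt hk0).hasFDerivAt
  obtain ⟨A, hA⟩ := heq y hy
  set e := (hcd y hy).toOpenPartialHomeomorph α hA hk0 with he
  have hcoe : (e : EuclideanSpace ℝ (Fin n) → EuclideanSpace ℝ (Fin n)) = α := rfl
  refine ⟨e.restrOpen _ h.isOpen_source, ?_, ?_, fun _ => rfl⟩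
  · have hs : (e.restrOpen _ h.isOpen_source).source = e.source ∩ (O.chart i).source := rfl
    refine ⟨?_, ?_, ?_, ?_, ?_⟩
    · rw [hs]; exact inter_subset_right
    · intro z hz
      have h1 := (e.restrOpen _ h.isOpen_source).map_target hz
      rw [hs] at h1
      have h2 := (e.restrOpen _ h.isOpen_source).right_inv hz
      rw [← h2]
      exact hα.mapsTo h1.2
    · rw [hs]
      exact hα.contDiffOn.mono inter_subset_right
    · intro z hz
      have h1 := (e.restrOpen _ h.isOpen_source).map_target hz
      rw [hs] at h1
      obtain ⟨B, hB⟩ := heq _ h1.2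
      exact ((e.restrOpen _ h.isOpen_source).contDiffAt_symm hz hB (hcd _ h1.2)).contDiffWithinAt
    · intro z hz
      rw [hs] at hz
      exact hα.proj_eq z hz.2
  · exact ⟨(hcd y hy).mem_toOpenPartialHomeomorph_source hA hk0, hy⟩

/-- Points of two charts over the same point of `X` are related by a change of coordinates. -/
theorem exists_transition (hk : 1 ≤ k) (O : Orbifold.{u, v} n k X) (i j : O.ι)
    {y z : EuclideanSpace ℝ (Fin n)} (hy : y ∈ (O.chart i).source) (hz : z ∈ (O.chart j).source)
    (hyz : (O.chart i).proj y = (O.chart j).proj z) :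
    ∃ ψ, O.IsTransition i j ψ ∧ y ∈ ψ.source ∧ ψ y = z := by
  have himg : ∀ a, IsOpen (O.chart a).image := fun a =>
    (O.isSmooth a).isOpen_proj_image _ Subset.rfl (O.isSmooth a).isOpen_source
  have key : ∀ (a l : O.ι) (w : EuclideanSpace ℝ (Fin n)), w ∈ (O.chart a).source →
      (O.chart l).image ⊆ (O.chart a).image → (O.chart l).proj 0 = (O.chart a).proj w →
      ∃ ψ, O.IsTransition l a ψ ∧ (0 : EuclideanSpace ℝ (Fin n)) ∈ ψ.source ∧ ψ 0 = w := by
    intro a l w hw hsub h0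
    obtain ⟨α, θ, hα⟩ := O.exists_embedding l a hsub
    have h0m := (O.isSmooth l).zero_mem
    obtain ⟨ψ, hψ, h0ψ, hψα⟩ := O.exists_transition_embedding hk hα h0m
    have h1 : (O.chart a).proj (α 0) = (O.chart a).proj w := by rw [hα.proj_eq _ h0m, h0]
    obtain ⟨γ, hγ⟩ := ((O.isSmooth a).proj_eq_iff _ (hα.mapsTo h0m) _ hw).1 h1
    obtain ⟨φ, hφ, hφs, hφγ⟩ := O.exists_transition_act a γ
    refine ⟨ψ.trans φ, hψ.trans hφ, ?_, ?_⟩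
    · rw [OpenPartialHomeomorph.trans_source]
      refine ⟨h0ψ, ?_⟩
      rw [mem_preimage, hψα, hφs]
      exact hα.mapsTo h0m
    · rw [OpenPartialHomeomorph.coe_trans, Function.comp_apply, hψα, hφγ, hγ]
  obtain ⟨l, hl0, hl⟩ := O.exists_chart ((O.chart i).proj y)
    ((O.chart i).image ∩ (O.chart j).image)
    (inter_mem ((himg i).mem_nhds ⟨y, hy, rfl⟩) ((himg j).mem_nhds ⟨z, hz, hyz.symm⟩))
  obtain ⟨ψ, hψ, h0ψ, hψy⟩ := key i l y hy (hl.trans inter_subset_left) hl0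
  obtain ⟨φ, hφ, h0φ, hφz⟩ := key j l z hz (hl.trans inter_subset_right) (hl0.trans hyz)
  refine ⟨ψ.symm.trans φ, hψ.symm.trans hφ, ?_, ?_⟩
  · rw [OpenPartialHomeomorph.trans_source]
    refine ⟨?_, ?_⟩
    · rw [OpenPartialHomeomorph.symm_source, ← hψy]
      exact ψ.map_source h0ψ
    · rw [mem_preimage, ← hψy, ψ.left_inv h0ψ]
      exact h0φ
  · rw [OpenPartialHomeomorph.coe_trans, Function.comp_apply, ← hψy, ψ.left_inv h0ψ, hφz]

/-- Two changes of coordinates that agree at a point with trivial stabilizer agree near it. -/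
theorem eventuallyEq_of_regular (O : Orbifold.{u, v} n k X) {i j : O.ι}
    {ψ φ : OpenPartialHomeomorph (EuclideanSpace ℝ (Fin n)) (EuclideanSpace ℝ (Fin n))}
    (hψ : O.IsTransition i j ψ) (hφ : O.IsTransition i j φ) {y : EuclideanSpace ℝ (Fin n)}
    (hyψ : y ∈ ψ.source) (hyφ : y ∈ φ.source) (hψφ : ψ y = φ y)
    (hreg : ∀ γ, (O.chart i).act γ y = y → γ = 1) : ψ =ᶠ[𝓝 y] φ := by
  have h := O.isSmooth i
  have := h.finite
  have hψc : ContinuousAt ψ y := ψ.continuousAt hyψ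
  have hφc : ContinuousAt φ y := φ.continuousAt hyφ
  have hmem : ∀ᶠ z in 𝓝 y, φ z ∈ ψ.target := by
    apply hφc.eventually_mem
    rw [← hψφ]
    exact ψ.open_target.mem_nhds (ψ.map_source hyψ)
  have hgc : ContinuousAt (fun z => ψ.symm (φ z)) y := by
    refine ContinuousAt.comp (g := ψ.symm) ?_ hφc
    rw [← hψφ]
    exact ψ.continuousAt_symm (ψ.map_source hyψ)
  have hgy : ψ.symm (φ y) = y := by rw [← hψφ, ψ.left_inv hyψ]
  have hne : ∀ᶠ z in 𝓝 y, ∀ γ : (O.chart i).Γ, γ ≠ 1 → (O.chart i).act γ z ≠ ψ.symm (φ z) := by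
    rw [eventually_all]
    intro γ
    by_cases h1 : γ = 1
    · simp [h1]
    · have hc : ContinuousAt ((O.chart i).act γ) y :=
        (h.continuousOn_act γ).continuousAt (h.isOpen_source.mem_nhds (hψ.source_subset hyψ))
      have h2 : (O.chart i).act γ y ≠ ψ.symm (φ y) := by
        rw [hgy]
        exact fun h3 => h1 (hreg γ h3)
      filter_upwards [(hc.ne_iff_eventually_ne hgc).1 h2] with z hz _ using hz
  filter_upwards [hmem, hne, φ.open_source.mem_nhds hyφ] with z hz1 hz2 hz3
  have hzs : z ∈ (O.chart i).source := hφ.source_subset hz3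
  have hp : (O.chart i).proj z = (O.chart i).proj (ψ.symm (φ z)) := by
    rw [← hφ.proj_eq z hz3, ← hψ.proj_eq _ (ψ.map_target hz1), ψ.right_inv hz1]
  obtain ⟨γ, hγ⟩ := (h.proj_eq_iff _ hzs _ (hψ.source_subset (ψ.map_target hz1))).1 hp
  have hγ1 : γ = 1 := by_contra fun h1 => hz2 γ h1 hγ
  rw [hγ1, h.act_one _ hzs] at hγ
  nth_rewrite 1 [hγ]
  exact ψ.right_inv hz1

/-- Tangent vectors `v` at points `y` of the sources of the charts. -/
abbrev LocalTangentVector (O : Orbifold.{u, v} n k X) : Type v :=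
  Σ i : O.ι, (O.chart i).source × EuclideanSpace ℝ (Fin n)

/-- Two tangent vectors in charts represent the same point of the tangent orbibundle if the
differential of a change of coordinates carries one to the other. -/
def tangentSetoid (O : Orbifold.{u, v} n (r + 1) X) : Setoid O.LocalTangentVector where
  r a b := ∃ ψ, O.IsTransition a.1 b.1 ψ ∧ (a.2.1 : EuclideanSpace ℝ (Fin n)) ∈ ψ.source ∧
    ψ a.2.1 = b.2.1 ∧ fderiv ℝ ψ a.2.1 a.2.2 = b.2.2
  iseqv := by
    have hk : (1 : ℕ∞) ≤ r + 1 := le_add_self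
    refine ⟨?_, ?_, ?_⟩
    · rintro ⟨i, y, v⟩
      refine ⟨_, IsTransition.refl O i, ?_, ?_, ?_⟩
      · simp
      · simp
      · simp
    · rintro ⟨i, y, v⟩ ⟨j, z, w⟩ ⟨ψ, hψ, hy, hyz, hvw⟩
      refine ⟨ψ.symm, hψ.symm, ?_, ?_, ?_⟩
      · simp only at hyz hy ⊢
        rw [OpenPartialHomeomorph.symm_source, ← hyz]
        exact ψ.map_source hy
      · simp only at hyz hy ⊢
        rw [← hyz, ψ.left_inv hy]
      · simp only at hyz hy hvw ⊢
        rw [← hyz, ← hvw]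
        exact hψ.fderiv_symm_fderiv hk hy v
    · rintro ⟨i, y, v⟩ ⟨j, z, w⟩ ⟨l, x, t⟩ ⟨ψ, hψ, hy, hyz, hvw⟩ ⟨φ, hφ, hz, hzx, hwt⟩
      simp only at hy hyz hvw hz hzx hwt
      refine ⟨ψ.trans φ, hψ.trans hφ, ?_, ?_, ?_⟩
      · simp only [OpenPartialHomeomorph.trans_source]
        exact ⟨hy, by rw [mem_preimage, hyz]; exact hz⟩
      · simp only [OpenPartialHomeomorph.coe_trans, Function.comp_apply]
        rw [hyz, hzx]
      · simp only
        rw [hψ.fderiv_trans hk hφ hy (by rw [hyz]; exact hz), hvw, hyz, hwt]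

/-- The total space of the tangent orbibundle, with the quotient topology. -/
def Tangent (O : Orbifold.{u, v} n (r + 1) X) : Type v := Quotient O.tangentSetoid

instance (O : Orbifold.{u, v} n (r + 1) X) : TopologicalSpace O.Tangent :=
  inferInstanceAs (TopologicalSpace (Quotient O.tangentSetoid))

/-- The point of the tangent orbibundle represented by the vector `v` at `y` in the chart `i`. -/
def tangentMk (O : Orbifold.{u, v} n (r + 1) X) (i : O.ι) (y : (O.chart i).source)
    (v : EuclideanSpace ℝ (Fin n)) : O.Tangent :=
  Quotient.mk O.tangentSetoid ⟨i, y, v⟩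

/-- The projection of the tangent orbibundle. -/
def tangentProj (O : Orbifold.{u, v} n (r + 1) X) : O.Tangent → X :=
  Quotient.lift (fun a => (O.chart a.1).proj a.2.1) (by
    rintro ⟨i, y, v⟩ ⟨j, z, w⟩ ⟨ψ, hψ, hy, hyz, -⟩
    simp only at hy hyz ⊢
    rw [← hyz, hψ.proj_eq _ hy])

open Classical in
/-- The chart of the tangent orbibundle over the chart `i`: the product of the source with the
vector space, with the action `γ (y, v) = (γ y, dγ_y v)`. (The value of `proj` at points that
are not in the source is arbitrary.) -/
noncomputable def tangentChart (O : Orbifold.{u, v} n (r + 1) X) (i : O.ι) :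
    OrbifoldChart (EuclideanSpace ℝ (Fin n) × EuclideanSpace ℝ (Fin n)) O.Tangent where
  source := (O.chart i).source ×ˢ univ
  Γ := (O.chart i).Γ
  act γ p := ((O.chart i).act γ p.1, fderiv ℝ ((O.chart i).act γ) p.1 p.2)
  proj p := if h : p.1 ∈ (O.chart i).source then O.tangentMk i ⟨p.1, h⟩ p.2
    else O.tangentMk i ⟨0, (O.isSmooth i).zero_mem⟩ 0

theorem tangentChart_proj (O : Orbifold.{u, v} n (r + 1) X) (i : O.ι)
    (p : EuclideanSpace ℝ (Fin n) × EuclideanSpace ℝ (Fin n)) (h : p.1 ∈ (O.chart i).source) :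
    (O.tangentChart i).proj p = O.tangentMk i ⟨p.1, h⟩ p.2 := dif_pos h

/-- `C^r` orbisections of the tangent orbibundle: continuous sections `σ` that have, over every
chart, an equivariant `C^r` lift whose first component is the identity. -/
structure Orbisection (O : Orbifold.{u, v} n (r + 1) X) where
  toFun : X → O.Tangent
  continuous_toFun : Continuous toFun
  proj_toFun : ∀ x, O.tangentProj (toFun x) = x
  exists_lift : ∀ i, ∃ F, OrbifoldChart.IsLift r (O.chart i) (O.tangentChart i) toFun F ∧
    ∀ y ∈ (O.chart i).source, (F y).1 = y

variable {O : Orbifold.{u, v} n (r + 1) X}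

/-- Coherence of local lifts under changes of coordinates. -/
theorem fderiv_transition_eq {σ : X → O.Tangent} {i j : O.ι}
    {s t : EuclideanSpace ℝ (Fin n) → EuclideanSpace ℝ (Fin n)}
    (hs : ContinuousOn s (O.chart i).source) (ht : ContinuousOn t (O.chart j).source)
    (hsσ : ∀ y : (O.chart i).source, O.tangentMk i y (s y) = σ ((O.chart i).proj y))
    (htσ : ∀ y : (O.chart j).source, O.tangentMk j y (t y) = σ ((O.chart j).proj y))
    {ψ : OpenPartialHomeomorph (EuclideanSpace ℝ (Fin n)) (EuclideanSpace ℝ (Fin n))}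
    (hψ : O.IsTransition i j ψ) {y : EuclideanSpace ℝ (Fin n)} (hy : y ∈ ψ.source) :
    fderiv ℝ ψ y (s y) = t (ψ y) := by
  have hk : (1 : ℕ∞) ≤ r + 1 := le_add_self
  have hk' : (1 : WithTop ℕ∞) ≤ ((r + 1 : ℕ∞) : WithTop ℕ∞) := by exact_mod_cast hk
  by_contra hcon
  have hdc : ContinuousOn (fderiv ℝ ψ) ψ.source :=
    hψ.contDiffOn.continuousOn_fderiv_of_isOpen ψ.open_source hk'
  have h1 : ContinuousOn (fun z => fderiv ℝ ψ z (s z)) ψ.source :=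
    hdc.clm_apply (hs.mono hψ.source_subset)
  have h2 : ContinuousOn (fun z => t (ψ z)) ψ.source :=
    ht.comp ψ.continuousOn (fun z hz => hψ.target_subset (ψ.map_source hz))
  set V : Set (EuclideanSpace ℝ (Fin n)) := ψ.source ∩ {z | fderiv ℝ ψ z (s z) ≠ t (ψ z)} with hV
  have hVo : IsOpen V := by
    rw [isOpen_iff_mem_nhds]
    rintro z ⟨hz, hzne⟩
    have hn := ψ.open_source.mem_nhds hz
    exact inter_mem hn (((h1.continuousAt hn).ne_iff_eventually_ne (h2.continuousAt hn)).1 hzne)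
  obtain ⟨z, ⟨hz, hzne⟩, hreg⟩ := (O.isSmooth i).exists_regular hk hVo
    (inter_subset_left.trans hψ.source_subset) ⟨y, hy, hcon⟩
  have hzi := hψ.source_subset hz
  have hzj := hψ.target_subset (ψ.map_source hz)
  have heq : O.tangentMk i ⟨z, hzi⟩ (s z) = O.tangentMk j ⟨ψ z, hzj⟩ (t (ψ z)) := by
    rw [hsσ ⟨z, hzi⟩, htσ ⟨ψ z, hzj⟩]
    simp only
    rw [hψ.proj_eq _ hz]
  obtain ⟨φ, hφ, hzφ, hφz, hφd⟩ := Quotient.exact heq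
  simp only at hzφ hφz hφd
  have := O.eventuallyEq_of_regular hψ hφ hz hzφ hφz.symm hreg
  exact hzne (by rw [this.fderiv_eq, hφd])

namespace Orbisection

/-- The second component of the lift of an orbisection over the chart `i`; on the source of the
chart it is uniquely determined. -/
noncomputable def field (σ : O.Orbisection) (i : O.ι) :
    EuclideanSpace ℝ (Fin n) → EuclideanSpace ℝ (Fin n) :=
  fun y => ((σ.exists_lift i).choose y).2

theorem contDiffOn_field (σ : O.Orbisection) (i : O.ι) :
    ContDiffOn ℝ r (σ.field i) (O.chart i).source :=
  (σ.exists_lift i).choose_spec.1.contDiffOn.snd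

theorem tangentMk_field (σ : O.Orbisection) (i : O.ι) (y : (O.chart i).source) :
    O.tangentMk i y (σ.field i y) = σ.toFun ((O.chart i).proj y) := by
  obtain ⟨h1, h2⟩ := (σ.exists_lift i).choose_spec
  have h3 := h1.proj_eq y y.2
  have h4 := h2 y y.2
  have h5 : ((σ.exists_lift i).choose y).1 ∈ (O.chart i).source := by rw [h4]; exact y.2
  rw [tangentChart_proj O i _ h5] at h3
  have h6 : (⟨((σ.exists_lift i).choose y).1, h5⟩ : (O.chart i).source) = y := Subtype.ext h4
  rw [h6] at h3
  exact h3

theorem fderiv_transition_field (σ : O.Orbisection) {i j : O.ι}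
    {ψ : OpenPartialHomeomorph (EuclideanSpace ℝ (Fin n)) (EuclideanSpace ℝ (Fin n))}
    (hψ : O.IsTransition i j ψ) {y : EuclideanSpace ℝ (Fin n)} (hy : y ∈ ψ.source) :
    fderiv ℝ ψ y (σ.field i y) = σ.field j (ψ y) :=
  fderiv_transition_eq (σ.contDiffOn_field i).continuousOn (σ.contDiffOn_field j).continuousOn
    (σ.tangentMk_field i) (σ.tangentMk_field j) hψ hy

/-- Uniqueness of local lifts. -/
theorem field_unique (σ : O.Orbisection) {i : O.ι}
    {s : EuclideanSpace ℝ (Fin n) → EuclideanSpace ℝ (Fin n)}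
    (hs : ContinuousOn s (O.chart i).source)
    (hsσ : ∀ y : (O.chart i).source, O.tangentMk i y (s y) = σ.toFun ((O.chart i).proj y))
    {y : EuclideanSpace ℝ (Fin n)} (hy : y ∈ (O.chart i).source) : s y = σ.field i y := by
  have h := fderiv_transition_eq hs (σ.contDiffOn_field i).continuousOn hsσ
    (σ.tangentMk_field i) (IsTransition.refl O i) (y := y) (by simpa using hy)
  simpa using h

theorem exists_chart_point (O : Orbifold.{u, v} n k X) (x : X) :
    ∃ i, ∃ y ∈ (O.chart i).source, (O.chart i).proj y = x := by
  obtain ⟨i, h0, -⟩ := O.exists_chart x univ univ_mem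
  exact ⟨i, 0, (O.isSmooth i).zero_mem, h0⟩

theorem ext_field {σ τ : O.Orbisection}
    (h : ∀ i, ∀ y ∈ (O.chart i).source, σ.field i y = τ.field i y) : σ = τ := by
  have : σ.toFun = τ.toFun := by
    funext x
    obtain ⟨i, y, hy, rfl⟩ := exists_chart_point O x
    rw [← σ.tangentMk_field i ⟨y, hy⟩, ← τ.tangentMk_field i ⟨y, hy⟩]
    simp only [h i y hy]
  cases σ; cases τ; cases this; rfl

/-- Families of `C^r` vector fields on the charts that are compatible with the changes of
coordinates. -/
structure IsCoherent (s : O.ι → EuclideanSpace ℝ (Fin n) → EuclideanSpace ℝ (Fin n)) :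
    Prop where
  contDiffOn : ∀ i, ContDiffOn ℝ r (s i) (O.chart i).source
  fderiv_eq : ∀ i j ψ, O.IsTransition i j ψ → ∀ y ∈ ψ.source, fderiv ℝ ψ y (s i y) = s j (ψ y)

theorem isCoherent_field (σ : O.Orbisection) : IsCoherent (O := O) σ.field :=
  ⟨σ.contDiffOn_field, fun _ _ _ hψ _ hy => σ.fderiv_transition_field hψ hy⟩

/-- A coherent family defines a map to the tangent orbibundle. -/
noncomputable def glueFun (s : O.ι → EuclideanSpace ℝ (Fin n) → EuclideanSpace ℝ (Fin n))
    (x : X) : O.Tangent :=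
  O.tangentMk (exists_chart_point O x).choose
    ⟨(exists_chart_point O x).choose_spec.choose,
      (exists_chart_point O x).choose_spec.choose_spec.1⟩
    (s (exists_chart_point O x).choose (exists_chart_point O x).choose_spec.choose)

theorem tangentMk_eq_glueFun
    {s : O.ι → EuclideanSpace ℝ (Fin n) → EuclideanSpace ℝ (Fin n)} (hs : IsCoherent (O := O) s)
    (i : O.ι) (y : (O.chart i).source) :
    O.tangentMk i y (s i y) = glueFun s ((O.chart i).proj y) := by
  have hx := exists_chart_point O ((O.chart i).proj y)
  obtain ⟨ψ, hψ, hy, hyz⟩ := O.exists_transition le_add_self i hx.choose y.2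
    hx.choose_spec.choose_spec.1 hx.choose_spec.choose_spec.2.symm
  have hd : fderiv ℝ ψ y (s i y) = s hx.choose hx.choose_spec.choose := by
    rw [hs.fderiv_eq _ _ ψ hψ _ hy, hyz]
  exact Quotient.sound (s := O.tangentSetoid) ⟨ψ, hψ, hy, hyz, hd⟩

/-- The orbisection with prescribed coherent local lifts. -/
noncomputable def glue (s : O.ι → EuclideanSpace ℝ (Fin n) → EuclideanSpace ℝ (Fin n))
    (hs : IsCoherent (O := O) s) : O.Orbisection where
  toFun := glueFun s
  continuous_toFun := by
    rw [continuous_iff_continuousAt]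
    intro x
    obtain ⟨i, y, hy, rfl⟩ := exists_chart_point O x
    have h := O.isSmooth i
    intro W hW
    have hc : ContinuousOn (fun z => glueFun s ((O.chart i).proj z)) (O.chart i).source := by
      rw [continuousOn_iff_continuous_domRestrict]
      have h1 : Continuous fun z : (O.chart i).source => O.tangentMk i z (s i z) := by
        have h2 : Continuous fun z : (O.chart i).source => (z, s i z) :=
          continuous_id.prodMk (continuousOn_iff_continuous_domRestrict.1
            (hs.contDiffOn i).continuousOn)
        have h3 : Continuous fun z : (O.chart i).source =>
            (⟨i, z, s i z⟩ : O.LocalTangentVector) := continuous_sigmaMk.comp h2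
        exact continuous_quotient_mk'.comp h3
      convert h1 using 1
      funext z
      exact (tangentMk_eq_glueFun hs i z).symm
    have h4 : (fun z => glueFun s ((O.chart i).proj z)) ⁻¹' W ∈ 𝓝 y :=
      (hc.continuousAt (h.isOpen_source.mem_nhds hy)) hW
    obtain ⟨V, hVs, hVo, hyV⟩ := mem_nhds_iff.1 (inter_mem h4 (h.isOpen_source.mem_nhds hy))
    refine mem_map.2 (mem_of_superset ((h.isOpen_proj_image V (fun z hz => (hVs hz).2) hVo).mem_nhds
      ⟨y, hyV, rfl⟩) ?_)
    rintro _ ⟨z, hz, rfl⟩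
    exact (hVs hz).1
  proj_toFun := fun x => (exists_chart_point O x).choose_spec.choose_spec.2
  exists_lift := fun i => by
    have h := O.isSmooth i
    refine ⟨fun y => (y, s i y), ⟨?_, ?_, ?_, ?_⟩, fun _ _ => rfl⟩
    · exact contDiffOn_id.prodMk (hs.contDiffOn i)
    · exact fun y hy => ⟨hy, mem_univ _⟩
    · intro y hy
      rw [tangentChart_proj O i _ hy]
      exact tangentMk_eq_glueFun hs i ⟨y, hy⟩
    · refine ⟨MonoidHom.id _, fun γ y hy => ?_⟩
      obtain ⟨ψ, hψ, hψs, hψγ⟩ := O.exists_transition_act i γ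
      have h1 := hs.fderiv_eq _ _ ψ hψ y (by rw [hψs]; exact hy)
      have h2 : (ψ : EuclideanSpace ℝ (Fin n) → EuclideanSpace ℝ (Fin n)) =
          (O.chart i).act γ := funext hψγ
      rw [h2] at h1
      exact Prod.ext rfl h1.symm

theorem field_glue {s : O.ι → EuclideanSpace ℝ (Fin n) → EuclideanSpace ℝ (Fin n)}
    (hs : IsCoherent (O := O) s) {i : O.ι} {y : EuclideanSpace ℝ (Fin n)}
    (hy : y ∈ (O.chart i).source) : (glue s hs).field i y = s i y :=
  ((glue s hs).field_unique (hs.contDiffOn i).continuousOn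
    (fun z => tangentMk_eq_glueFun hs i z) hy).symm

/-! The vector space operations are the pointwise operations on local lifts. -/

noncomputable instance : Zero O.Orbisection :=
  ⟨glue (fun _ _ => 0) ⟨fun _ => contDiffOn_const, fun _ _ _ _ _ _ => map_zero _⟩⟩

noncomputable instance : Add O.Orbisection :=
  ⟨fun σ τ => glue (fun i y => σ.field i y + τ.field i y)
    ⟨fun i => (σ.contDiffOn_field i).add (τ.contDiffOn_field i), fun _ _ _ hψ _ hy => by
      rw [map_add, σ.fderiv_transition_field hψ hy, τ.fderiv_transition_field hψ hy]⟩⟩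

noncomputable instance : Neg O.Orbisection :=
  ⟨fun σ => glue (fun i y => -σ.field i y)
    ⟨fun i => (σ.contDiffOn_field i).neg, fun _ _ _ hψ _ hy => by
      rw [map_neg, σ.fderiv_transition_field hψ hy]⟩⟩

noncomputable instance : SMul ℝ O.Orbisection :=
  ⟨fun a σ => glue (fun i y => a • σ.field i y)
    ⟨fun i => (σ.contDiffOn_field i).const_smul a, fun _ _ _ hψ _ hy => by
      rw [map_smul, σ.fderiv_transition_field hψ hy]⟩⟩

section

variable (σ τ : O.Orbisection) (a : ℝ) {i : O.ι} {y : EuclideanSpace ℝ (Fin n)}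

theorem field_zero (hy : y ∈ (O.chart i).source) : (0 : O.Orbisection).field i y = 0 :=
  field_glue _ hy

theorem field_add (hy : y ∈ (O.chart i).source) :
    (σ + τ).field i y = σ.field i y + τ.field i y := field_glue _ hy

theorem field_neg (hy : y ∈ (O.chart i).source) : (-σ).field i y = -σ.field i y :=
  field_glue _ hy

theorem field_smul (hy : y ∈ (O.chart i).source) : (a • σ).field i y = a • σ.field i y :=
  field_glue _ hy

end

noncomputable instance : AddCommGroup O.Orbisection where
  add_assoc σ τ υ := ext_field fun i y hy => by simp only [field_add _ _ hy, add_assoc]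
  zero_add σ := ext_field fun i y hy => by rw [field_add _ _ hy, field_zero hy, zero_add]
  add_zero σ := ext_field fun i y hy => by rw [field_add _ _ hy, field_zero hy, add_zero]
  nsmul := nsmulRec
  zsmul := zsmulRec
  neg_add_cancel σ := ext_field fun i y hy => by
    rw [field_add _ _ hy, field_neg _ hy, field_zero hy, neg_add_cancel]
  add_comm σ τ := ext_field fun i y hy => by rw [field_add _ _ hy, field_add _ _ hy, add_comm]

noncomputable instance : Module ℝ O.Orbisection where
  one_smul σ := ext_field fun i y hy => by rw [field_smul _ _ hy, one_smul]
  mul_smul a b σ := ext_field fun i y hy => by simp only [field_smul _ _ hy, mul_smul]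
  smul_zero a := ext_field fun i y hy => by
    rw [field_smul _ _ hy, field_zero hy, smul_zero]
  smul_add a σ τ := ext_field fun i y hy => by
    simp only [field_smul _ _ hy, field_add _ _ hy, smul_add]
  add_smul a b σ := ext_field fun i y hy => by
    simp only [field_smul _ _ hy, field_add _ _ hy, add_smul]
  zero_smul σ := ext_field fun i y hy => by rw [field_smul _ _ hy, field_zero hy, zero_smul]

end Orbisection

/-- A finite cover of `X` by relatively compact open sets `C a`, each given with an orbifold chart
whose image contains the closure of `C a`. -/
structure Cover {n : ℕ} {k : ℕ∞} {X : Type u} [TopologicalSpace X]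
    (O : Orbifold.{u, v} n k X) where
  N : ℕ
  C : Fin N → Set X
  idx : Fin N → O.ι
  isOpen : ∀ a, IsOpen (C a)
  isCompact_closure : ∀ a, IsCompact (closure (C a))
  closure_subset : ∀ a, closure (C a) ⊆ (O.chart (idx a)).image
  iUnion_eq : ⋃ a, C a = univ

/-- The neighborhood `N^s(σ, ε)` of an orbisection `σ` relative to the cover `𝒞`: all
orbisections whose lifts over the sets of `𝒞` have derivatives of order at most `s` that differ
by less than `ε` from those of the lifts of `σ`. (The first components of the lifts of two
orbisections agree, so that only the second components enter.) -/
def Cover.nhd {O : Orbifold.{u, v} n (r + 1) X} (𝒞 : O.Cover) (s : ℕ) (ε : ℝ)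
    (σ : O.Orbisection) : Set O.Orbisection :=
  {τ | ∀ a, ∀ m ≤ s, ∀ y ∈ (O.chart (𝒞.idx a)).source, (O.chart (𝒞.idx a)).proj y ∈ 𝒞.C a →
    ‖iteratedFDeriv ℝ m (σ.field (𝒞.idx a)) y - iteratedFDeriv ℝ m (τ.field (𝒞.idx a)) y‖ < ε}

end Orbifold

/-- The topology in which the sets `N s ε v`, with `s ≤ r` finite and `ε > 0`, are the basic
neighborhoods of `v`. -/
@[reducible] def topologyOfNhds {V : Type*} (r : ℕ∞) (N : ℕ → ℝ → V → Set V)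
    (hN : ∀ s s' ε ε' v, s ≤ s' → ε' ≤ ε → N s' ε' v ⊆ N s ε v) : TopologicalSpace V where
  IsOpen U := ∀ v ∈ U, ∃ s : ℕ, (s : ℕ∞) ≤ r ∧ ∃ ε > 0, N s ε v ⊆ U
  isOpen_univ _ _ := ⟨0, by simp, 1, one_pos, subset_univ _⟩
  isOpen_inter U W hU hW v hv := by
    obtain ⟨s, hs, ε, hε, h⟩ := hU v hv.1
    obtain ⟨s', hs', ε', hε', h'⟩ := hW v hv.2
    refine ⟨max s s', ?_, min ε ε', lt_min hε hε', subset_inter ?_ ?_⟩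
    · rcases max_cases s s' with h1 | h1 <;> rw [h1.1] <;> assumption
    · exact (hN _ _ _ _ _ (le_max_left _ _) (min_le_left _ _)).trans h
    · exact (hN _ _ _ _ _ (le_max_right _ _) (min_le_right _ _)).trans h'
  isOpen_sUnion S hS v hv := by
    obtain ⟨U, hU, hvU⟩ := hv
    obtain ⟨s, hs, ε, hε, h⟩ := hS U hU v hvU
    exact ⟨s, hs, ε, hε, h.trans (subset_sUnion_of_mem hU)⟩

/-- The `C^r` topology on the space of `C^r` orbisections, relative to the cover `𝒞`. -/
@[reducible] def Orbifold.Cover.crTopology {n : ℕ} {r : ℕ∞} {X : Type u} [TopologicalSpace X]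
    {O : Orbifold.{u, v} n (r + 1) X} (𝒞 : O.Cover) : TopologicalSpace O.Orbisection :=
  topologyOfNhds r 𝒞.nhd (fun _ _ _ _ _ hs hε _ h a m hm y hy hyC =>
    (h a m (hm.trans hs) y hy hyC).trans_le hε)

section CrSpace

variable {E : Type*} [NormedAddCommGroup E] [NormedSpace ℝ E]
  (F : Type*) [NormedAddCommGroup F] [NormedSpace ℝ F]

/-- The space of `C^r` functions from the subset `K` of `E` to `F`. -/
def crSubmodule (r : ℕ∞) (K : Set E) : Submodule ℝ (K → F) where
  carrier := {f | ContDiffOn ℝ r (Function.extend Subtype.val f 0) K}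
  add_mem' {f g} hf hg := (ContDiffOn.add hf hg).congr fun y hy => by
    have h : ∀ φ : K → F, Function.extend Subtype.val φ 0 y = φ ⟨y, hy⟩ := fun φ =>
      Subtype.val_injective.extend_apply φ 0 ⟨y, hy⟩
    simp only [h, Pi.add_apply]
  zero_mem' := (contDiffOn_const (c := (0 : F))).congr fun y hy =>
    Subtype.val_injective.extend_apply (0 : K → F) 0 ⟨y, hy⟩
  smul_mem' a f hf := (ContDiffOn.const_smul a hf).congr fun y hy => by
    have h : ∀ φ : K → F, Function.extend Subtype.val φ 0 y = φ ⟨y, hy⟩ := fun φ =>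
      Subtype.val_injective.extend_apply φ 0 ⟨y, hy⟩
    simp only [h, Pi.smul_apply]

/-- `C^r(K, F)`; its topology is that of uniform convergence of the derivatives of order at
most `r` (of every order if `r = ∞`). -/
def CrSpace (r : ℕ∞) (K : Set E) : Type _ := crSubmodule F r K

instance (r : ℕ∞) (K : Set E) : AddCommGroup (CrSpace F r K) :=
  inferInstanceAs (AddCommGroup (crSubmodule F r K))

instance (r : ℕ∞) (K : Set E) : Module ℝ (CrSpace F r K) :=
  inferInstanceAs (Module ℝ (crSubmodule F r K))

variable {F}

/-- The values of an element of `C^r(K, F)`, extended by zero. -/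
noncomputable def CrSpace.val {r : ℕ∞} {K : Set E} (f : CrSpace F r K) : E → F :=
  Function.extend Subtype.val f.1 0

/-- The functions whose derivatives of order at most `s` are `ε`-close to those of `f` on `K`. -/
def CrSpace.nhd {r : ℕ∞} {K : Set E} (s : ℕ) (ε : ℝ) (f : CrSpace F r K) :
    Set (CrSpace F r K) :=
  {g | ∀ m ≤ s, ∀ y ∈ K,
    ‖iteratedFDerivWithin ℝ m f.val K y - iteratedFDerivWithin ℝ m g.val K y‖ < ε}

instance (r : ℕ∞) (K : Set E) : TopologicalSpace (CrSpace F r K) :=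
  topologyOfNhds r CrSpace.nhd (fun _ _ _ _ _ hs hε _ h m hm y hy =>
    (h m (hm.trans hs) y hy).trans_le hε)

end CrSpace

/-- The topological vector space `V` is a separable Banach space: its topology is given by a
complete norm, and it is separable. -/
def IsSeparableBanachSpace (V : Type u) [AddCommGroup V] [Module ℝ V] [TopologicalSpace V] :
    Prop :=
  ∃ (B : Type u) (_ : NormedAddCommGroup B) (_ : NormedSpace ℝ B),
    CompleteSpace B ∧ TopologicalSpace.SeparableSpace B ∧ Nonempty (V ≃L[ℝ] B)

/-- `V` is a separable Fréchet space: a complete metrizable locally convex topological vector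
space that is separable. -/
structure IsSeparableFrechetSpace (V : Type u) [AddCommGroup V] [Module ℝ V]
    [TopologicalSpace V] : Prop where
  isTopologicalAddGroup : IsTopologicalAddGroup V
  continuousSMul : ContinuousSMul ℝ V
  locallyConvexSpace : LocallyConvexSpace ℝ V
  metrizableSpace : TopologicalSpace.MetrizableSpace V
  completeSpace : @CompleteSpace V (IsTopologicalAddGroup.rightUniformSpace V)
  separableSpace : TopologicalSpace.SeparableSpace V

/-! The orbisections are embedded as a closed subspace in a product of Banach spaces of continuous
functions. Choose finitely many compact sets `K a` in chart sources whose images cover `X`, and send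
an orbisection to its jet: all derivatives of order at most `r` of its lifts, as elements of `C(K a,
·)`. The target is complete, second countable and locally convex; it is a finite product of Banach
spaces if `r < ∞` and a countable one if `r = ∞`. Once the jet map is a closed embedding, the Banach
and Fréchet assertions are inherited.

Everything rests on one a priori estimate, `Orbifold.Orbisection.exists_bound`: on a compact part of
any chart, the derivatives of order at most `s` of a lift are bounded by a constant times their
bound on any family of sets whose images cover `X` and which lie in compact parts of finitely many
charts. Under a change of coordinates `ψ` from chart `i` to chart `j` the lifts satisfy `s_i = (dψ⁻¹
∘ ψ) (s_j ∘ ψ)`, so the Leibniz rule and the estimate for derivatives of a composition apply. Here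
`ψ` is of class `C^{r+1}`, so its differential is of class `C^r`. Two lifts of a point differ by one
of finitely many group elements, and compactness makes the constant uniform.

The estimate has three consequences. The jet map is injective. The `C^r` topology is the one induced
by the jet map (`crTopology_eq_induced_jet`), hence it does not depend on the cover. The range is
closed (`isClosed_range_jet`): if jets converge, the lifts over every chart converge locally
uniformly with their derivatives, the limits are still compatible with changes of coordinates, and
they glue.

For the realization in `C^r` of closed balls, the jet map factors through restriction to the balls
followed by the jet map of these function spaces, which is an embedding. Hence restriction is a
closed embedding as well, and completeness of the spaces on the balls need not be known. -/

/-! ### Topologies given by basic neighborhoods -/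

/-- If the sets `N s ε v` are comparable with the preimages of balls under the components of `J`,
they are the basic neighborhoods of the topology induced by `J`. -/
theorem topologyOfNhds_eq_induced {V A : Type*} [Finite A] {r : ℕ∞}
    {Z : A → {m : ℕ // (m : ℕ∞) ≤ r} → Type*} [∀ a m, PseudoMetricSpace (Z a m)]
    {N : ℕ → ℝ → V → Set V} (hN : ∀ s s' ε ε' v, s ≤ s' → ε' ≤ ε → N s' ε' v ⊆ N s ε v)
    (J : V → (a : A) → (m : {m : ℕ // (m : ℕ∞) ≤ r}) → Z a m)
    (h1 : ∀ s : ℕ, (s : ℕ∞) ≤ r → ∀ ε > 0, ∃ δ > 0, ∀ v w,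
      (∀ a (m : {m : ℕ // (m : ℕ∞) ≤ r}), m.1 ≤ s → dist (J w a m) (J v a m) < δ) → w ∈ N s ε v)
    (h2 : ∀ s : ℕ, (s : ℕ∞) ≤ r → ∀ ε > 0, ∃ δ > 0, ∀ v, ∀ w ∈ N s δ v,
      ∀ a (m : {m : ℕ // (m : ℕ∞) ≤ r}), m.1 ≤ s → dist (J w a m) (J v a m) < ε) :
    topologyOfNhds r N hN = TopologicalSpace.induced J inferInstance := by
  have key : ∀ (v : V) (U : Set V), U ∈ comap J (𝓝 (J v)) ↔
      ∃ s : ℕ, (s : ℕ∞) ≤ r ∧ ∃ ε > 0, N s ε v ⊆ U := by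
    intro v U
    constructor
    · rintro ⟨W, hW, hWU⟩
      suffices H : ∀ W ∈ 𝓝 (J v), ∃ s : ℕ, (s : ℕ∞) ≤ r ∧ ∃ ε > 0, N s ε v ⊆ J ⁻¹' W by
        obtain ⟨s, hs, ε, hε, h⟩ := H W hW
        exact ⟨s, hs, ε, hε, h.trans hWU⟩
      have hle : (⨅ (s : ℕ) (_ : (s : ℕ∞) ≤ r) (ε : ℝ) (_ : 0 < ε), 𝓟 (N s ε v)) ≤
          comap J (𝓝 (J v)) := by
        rw [← tendsto_iff_comap, tendsto_pi_nhds]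
        intro a
        rw [tendsto_pi_nhds]
        intro m
        rw [Metric.tendsto_nhds]
        intro ε hε
        obtain ⟨δ, hδ, h⟩ := h2 m.1 m.2 ε hε
        refine mem_of_superset ?_ (fun w hw => h v w hw a m le_rfl)
        exact mem_iInf_of_mem m.1 (mem_iInf_of_mem m.2 (mem_iInf_of_mem δ
          (mem_iInf_of_mem hδ (mem_principal_self _))))
      clear hWU
      intro W hW
      have hW' := hle (preimage_mem_comap hW)
      -- By monotonicity in `s` and `ε` the sets `N s ε v` are directed downwards, so a member of
      -- the infimum of their principal filters already contains a single one of them.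
      let B : FilterBasis V :=
        { sets := {S | ∃ s : ℕ, (s : ℕ∞) ≤ r ∧ ∃ ε > 0, S = N s ε v}
          nonempty := ⟨_, 0, by simp, 1, one_pos, rfl⟩
          inter_sets := by
            rintro _ _ ⟨s, hs, ε, hε, rfl⟩ ⟨s', hs', ε', hε', rfl⟩
            refine ⟨_, ⟨max s s', ?_, min ε ε', lt_min hε hε', rfl⟩, subset_inter ?_ ?_⟩
            · rcases max_cases s s' with h1 | h1 <;> rw [h1.1] <;> assumption
            · exact hN _ _ _ _ _ (le_max_left _ _) (min_le_left _ _)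
            · exact hN _ _ _ _ _ (le_max_right _ _) (min_le_right _ _) }
      have hB : B.filter ≤ ⨅ (s : ℕ) (_ : (s : ℕ∞) ≤ r) (ε : ℝ) (_ : 0 < ε), 𝓟 (N s ε v) := by
        refine le_iInf fun s => le_iInf fun hs => le_iInf fun ε => le_iInf fun hε => ?_
        rw [le_principal_iff]
        exact B.mem_filter_of_mem ⟨s, hs, ε, hε, rfl⟩
      obtain ⟨_, ⟨s, hs, ε, hε, rfl⟩, h⟩ := B.mem_filter_iff.1 (hB hW')
      exact ⟨s, hs, ε, hε, h⟩
    · rintro ⟨s, hs, ε, hε, h⟩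
      obtain ⟨δ, hδ, hd⟩ := h1 s hs ε hε
      -- A neighborhood in the product may constrain only finitely many coordinates. Since `s` is
      -- finite, this holds even when `r = ∞`.
      have hfin : Finite {m : {m : ℕ // (m : ℕ∞) ≤ r} // m.1 ≤ s} :=
        Finite.of_injective (fun m => (⟨m.1.1, Nat.lt_succ_of_le m.2⟩ : Fin (s + 1)))
          fun m m' h => Subtype.ext (Subtype.ext (congrArg Fin.val h))
      have : ∀ᶠ w in comap J (𝓝 (J v)), ∀ (a : A) (m : {m : {m : ℕ // (m : ℕ∞) ≤ r} // m.1 ≤ s}),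
          dist (J w a m.1) (J v a m.1) < δ := by
        rw [eventually_all]
        intro a
        rw [eventually_all]
        intro m
        have hc : Tendsto (fun w => J w a m.1) (comap J (𝓝 (J v))) (𝓝 (J v a m.1)) :=
          ((tendsto_pi_nhds.1 ((tendsto_pi_nhds.1 tendsto_comap) a)) m.1)
        exact hc (Metric.ball_mem_nhds _ hδ)
      filter_upwards [this] with w hw using h (hd v w fun a m hm => hw a ⟨m, hm⟩)
  refine TopologicalSpace.ext_iff.2 fun U => ?_
  refine Iff.trans ?_ (@isOpen_iff_mem_nhds V (TopologicalSpace.induced J inferInstance) U).symm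
  refine forall₂_congr fun v _ => ?_
  rw [@nhds_induced _ _ _ J v, key]

/-! ### Inheritance along closed embeddings -/

theorem isSeparableBanachSpace_of_isClosedEmbedding {V : Type u} [AddCommGroup V] [Module ℝ V]
    [TopologicalSpace V] {W : Type} [NormedAddCommGroup W] [NormedSpace ℝ W] [CompleteSpace W]
    [SecondCountableTopology W] (J : V →ₗ[ℝ] W) (hJ : IsClosedEmbedding J) :
    IsSeparableBanachSpace V := by
  let R : Submodule ℝ W := LinearMap.range J
  have hcl : IsClosed (R : Set W) := by
    rw [LinearMap.coe_range]
    exact hJ.isClosed_range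
  have hc : CompleteSpace R := hcl.completeSpace_coe
  let e : V ≃ₗ[ℝ] R := LinearEquiv.ofInjective J hJ.injective
  have he : IsInducing e := by
    rw [← IsInducing.subtypeVal.of_comp_iff]
    exact hJ.isInducing
  let e' : V ≃L[ℝ] R :=
    { e with
      continuous_toFun := he.continuous
      continuous_invFun := by
        have h : e ∘ e.symm = id := funext e.apply_symm_apply
        have := he.continuous_iff (f := e.symm)
        rw [h] at this
        exact this.2 continuous_id }
  -- The range lives in `Type`, but the model Banach space has to live in the universe of `V`.
  refine ⟨ULift.{u} R, inferInstance, inferInstance, inferInstance, ?_,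
    ⟨e'.trans ContinuousLinearEquiv.ulift.symm⟩⟩
  exact (Homeomorph.ulift (X := R)).symm.surjective.denseRange.separableSpace
    (Homeomorph.ulift (X := R)).symm.continuous

/-- All the properties pull back along an inducing linear map. For completeness, an inducing
homomorphism of topological groups is uniformly inducing, so completeness of the closed range passes
to `V`. Separability passes to subspaces through second countability. -/
theorem isSeparableFrechetSpace_of_isClosedEmbedding {V : Type u} [AddCommGroup V] [Module ℝ V]
    [TopologicalSpace V] {W : Type*} [AddCommGroup W] [Module ℝ W] [UniformSpace W]
    [IsUniformAddGroup W] [ContinuousSMul ℝ W] [LocallyConvexSpace ℝ W] [CompleteSpace W]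
    [TopologicalSpace.MetrizableSpace W] [SecondCountableTopology W]
    (J : V →ₗ[ℝ] W) (hJ : IsClosedEmbedding J) : IsSeparableFrechetSpace V := by
  have h1 : IsTopologicalAddGroup V := hJ.isInducing.topologicalAddGroup J
  have h2 : ContinuousSMul ℝ V := hJ.isInducing.continuousSMul continuous_id (map_smul J _ _)
  have h3 : LocallyConvexSpace ℝ V := by
    have := LocallyConvexSpace.induced (𝕜 := ℝ) J
    rwa [← hJ.isInducing.eq_induced] at this
  have h4 : SecondCountableTopology V := hJ.isEmbedding.secondCountableTopology
  refine ⟨h1, h2, h3, hJ.isEmbedding.metrizableSpace, ?_, inferInstance⟩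
  let _ : UniformSpace V := IsTopologicalAddGroup.rightUniformSpace V
  have : IsUniformAddGroup V := isUniformAddGroup_of_addCommGroup
  have hu : IsUniformInducing J := AddMonoidHom.isUniformInducing_of_isInducing hJ.isInducing
  exact hu.completeSpace hJ.isClosed_range.isComplete

/-! ### Limits and estimates for iterated derivatives -/

section Limit

variable {E F : Type*} [NormedAddCommGroup E] [NormedSpace ℝ E]
  [NormedAddCommGroup F] [NormedSpace ℝ F]

/-- The space of `C^r` functions on an open set is complete under locally uniform convergence of
the derivatives. -/
theorem exists_contDiffOn_of_uniformCauchySeqOn [CompleteSpace F] {r : ℕ∞} {U : Set E}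
    (hU : IsOpen U) {f : ℕ → E → F} (hf : ∀ k, ContDiffOn ℝ r (f k) U)
    (h : ∀ m : ℕ, (m : ℕ∞) ≤ r → ∀ y ∈ U, ∃ L ∈ 𝓝 y,
      UniformCauchySeqOn (fun k => iteratedFDerivWithin ℝ m (f k) U) atTop L) :
    ∃ g : E → F, ContDiffOn ℝ r g U ∧ ∀ m : ℕ, (m : ℕ∞) ≤ r → ∀ y ∈ U,
      Tendsto (fun k => iteratedFDerivWithin ℝ m (f k) U y) atTop
        (𝓝 (iteratedFDerivWithin ℝ m g U y)) := by
  classical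
  have hlim : ∀ y, ∀ m : ℕ, ∃ p : E [×m]→L[ℝ] F, y ∈ U → (m : ℕ∞) ≤ r →
      Tendsto (fun k => iteratedFDerivWithin ℝ m (f k) U y) atTop (𝓝 p) := by
    intro y m
    by_cases hc : y ∈ U ∧ (m : ℕ∞) ≤ r
    · obtain ⟨L, hL, hu⟩ := h m hc.2 y hc.1
      obtain ⟨p, hp⟩ := cauchySeq_tendsto_of_complete (hu.cauchySeq (mem_of_mem_nhds hL))
      exact ⟨p, fun _ _ => hp⟩
    · exact ⟨0, fun h1 h2 => absurd ⟨h1, h2⟩ hc⟩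
  choose p hp using hlim
  have hloc : ∀ m : ℕ, (m : ℕ∞) ≤ r → TendstoLocallyUniformlyOn
      (fun k => iteratedFDerivWithin ℝ m (f k) U) (fun y => p y m) atTop U := by
    intro m hm
    rw [tendstoLocallyUniformlyOn_iff_forall_tendsto]
    intro y hy
    obtain ⟨L, hL, hu⟩ := h m hm y hy
    have hL' : L ∩ U ∈ 𝓝 y := inter_mem hL (hU.mem_nhds hy)
    have h1 : TendstoUniformlyOn (fun k => iteratedFDerivWithin ℝ m (f k) U) (fun y => p y m)
        atTop (L ∩ U) :=
      (hu.mono inter_subset_left).tendstoUniformlyOn_of_tendsto fun z hz => hp z m hz.2 hm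
    rw [tendstoUniformlyOn_iff_tendsto] at h1
    -- Uniform convergence on a neighborhood of each point is locally uniform convergence.
    refine h1.mono_left (Filter.prod_mono le_rfl ?_)
    exact nhdsWithin_le_nhds.trans (le_principal_iff.2 hL')
  -- The limits `p` form a Taylor series of the limit function: locally uniform convergence of the
  -- derivatives of order `m + 1` allows the limit of those of order `m` to be differentiated, and
  -- it keeps the limits continuous.
  have hser : HasFTaylorSeriesUpToOn r (fun y => (p y 0).curry0) p U := by
    refine ⟨fun _ _ => rfl, ?_, ?_⟩
    · intro m hm y hy
      have hm' : (m : ℕ∞) < r := by exact_mod_cast hm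
      have hm1 : ((m + 1 : ℕ) : ℕ∞) ≤ r := by exact_mod_cast Order.add_one_le_of_lt hm'
      refine HasFDerivAt.hasFDerivWithinAt ?_
      refine hasFDerivAt_of_tendstoLocallyUniformlyOn (l := atTop) hU
        (f' := fun k z => (iteratedFDerivWithin ℝ (m + 1) (f k) U z).curryLeft)
        (g' := fun z => (p z (m + 1)).curryLeft) ?_ ?_
        (fun z hz => hp z m hz hm'.le) hy
      · exact (continuousMultilinearCurryLeftEquiv ℝ (fun _ : Fin (m + 1) => E)
          F).isometry.uniformContinuous.comp_tendstoLocallyUniformlyOn (hloc _ hm1)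
      · intro k z hz
        exact (((hf k).ftaylorSeriesWithin hU.uniqueDiffOn).fderivWithin m hm z hz).hasFDerivAt
          (hU.mem_nhds hz)
    · intro m hm
      refine (hloc m (by exact_mod_cast hm)).continuousOn (Frequently.of_forall fun k => ?_)
      exact (hf k).continuousOn_iteratedFDerivWithin hm hU.uniqueDiffOn
  refine ⟨_, hser.contDiffOn, fun m hm y hy => ?_⟩
  rw [← hser.eq_iteratedFDerivWithin_of_uniqueDiffOn (by exact_mod_cast hm) hU.uniqueDiffOn hy]
  exact hp y m hy hm

/-- Continuity of finitely many derivatives bounds them near a point. The normalization `1 ≤ B`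
gives `B ≤ B ^ i` for `i ≥ 1` and `B ^ l ≤ B ^ s` for `l ≤ s`, as the estimate for compositions
requires. -/
theorem exists_norm_iteratedFDerivWithin_le {s : ℕ} {U : Set E} (hU : IsOpen U) {f : E → F}
    (hf : ContDiffOn ℝ s f U) {y : E} (hy : y ∈ U) :
    ∃ B : ℝ, 1 ≤ B ∧ ∀ᶠ z in 𝓝 y, ∀ m ≤ s, ‖iteratedFDerivWithin ℝ m f U z‖ ≤ B := by
  have h : ∀ m : Fin (s + 1), ∃ B : ℝ, ∀ᶠ z in 𝓝 y, ‖iteratedFDerivWithin ℝ m f U z‖ ≤ B := by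
    intro m
    have hc : ContinuousAt (iteratedFDerivWithin ℝ m f U) y :=
      (hf.continuousOn_iteratedFDerivWithin (by exact_mod_cast Nat.le_of_lt_succ m.2)
        hU.uniqueDiffOn).continuousAt (hU.mem_nhds hy)
    exact ⟨_, (hc.norm.eventually_lt_const (lt_add_one _)).mono fun _ => le_of_lt⟩
  choose B hB using h
  refine ⟨1 + ∑ m, |B m|, le_add_of_nonneg_right (Finset.sum_nonneg fun _ _ => abs_nonneg _), ?_⟩
  filter_upwards [eventually_all.2 hB] with z hz m hm
  have h1 := hz ⟨m, Nat.lt_succ_of_le hm⟩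
  have h2 := Finset.single_le_sum (f := fun m => |B m|) (fun _ _ => abs_nonneg _)
    (Finset.mem_univ (⟨m, Nat.lt_succ_of_le hm⟩ : Fin (s + 1)))
  have h3 := le_abs_self (B ⟨m, Nat.lt_succ_of_le hm⟩)
  simp only at h1 h2
  linarith

/-- The derivatives of `z ↦ A z (g (φ z))` are controlled, near a given point, by those of `g`. -/
theorem exists_norm_iteratedFDerivWithin_clm_comp_le {G H : Type*} [NormedAddCommGroup G]
    [NormedSpace ℝ G] [NormedAddCommGroup H] [NormedSpace ℝ H] {s : ℕ} {U : Set E} {W : Set F}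
    (hU : IsOpen U) (hW : IsOpen W) {φ : E → F} {A : E → G →L[ℝ] H} (hφ : ContDiffOn ℝ s φ U)
    (hφW : MapsTo φ U W) (hA : ContDiffOn ℝ s A U) {y : E} (hy : y ∈ U) :
    ∃ M : ℝ, 0 < M ∧ ∀ᶠ z in 𝓝 y, ∀ g : F → G, ContDiffOn ℝ s g W → ∀ D : ℝ,
      (∀ m ≤ s, ‖iteratedFDerivWithin ℝ m g W (φ z)‖ ≤ D) →
      ∀ m ≤ s, ‖iteratedFDerivWithin ℝ m (fun x => A x (g (φ x))) U z‖ ≤ M * D := by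
  obtain ⟨B, hB1, hB⟩ := exists_norm_iteratedFDerivWithin_le hU hφ hy
  obtain ⟨B', hB1', hB'⟩ := exists_norm_iteratedFDerivWithin_le hU hA hy
  -- The factor `s! * B ^ s` comes from the composition with `φ`, `B'` bounds the derivatives of
  -- `A`, and `2 ^ s` dominates the sum of the binomial coefficients in the Leibniz rule. None of
  -- them depends on `g`.
  refine ⟨2 ^ s * B' * (s.factorial * B ^ s), by positivity, ?_⟩
  filter_upwards [hB, hB', hU.mem_nhds hy] with z hz hz' hzU g hg D hD m hm
  have hD0 : 0 ≤ D := (norm_nonneg _).trans (hD 0 (Nat.zero_le _))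
  have hcomp : ∀ l ≤ s, ‖iteratedFDerivWithin ℝ l (g ∘ φ) U z‖ ≤ s.factorial * B ^ s * D := by
    intro l hl
    refine (norm_iteratedFDerivWithin_comp_le hg hφ (by exact_mod_cast hl) hW.uniqueDiffOn
      hU.uniqueDiffOn hφW hzU (C := D) (D := B) (fun i hi => hD i (hi.trans hl))
      (fun i hi1 hi => (hz i (hi.trans hl)).trans (le_self_pow₀ hB1 (by omega)))).trans ?_
    have h1 : (l.factorial : ℝ) ≤ s.factorial := by exact_mod_cast Nat.factorial_le hl
    have h2 : B ^ l ≤ B ^ s := pow_le_pow_right₀ hB1 hl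
    calc (l.factorial : ℝ) * D * B ^ l ≤ s.factorial * D * B ^ s := by gcongr
      _ = _ := by ring
  refine (norm_iteratedFDerivWithin_clm_apply hA (hg.comp hφ hφW) hU.uniqueDiffOn hzU
    (by exact_mod_cast hm)).trans ?_
  calc _ ≤ ∑ i ∈ Finset.range (m + 1), (m.choose i : ℝ) * B' * (s.factorial * B ^ s * D) := by
        refine Finset.sum_le_sum fun i hi => ?_
        have hi' : i ≤ m := Nat.le_of_lt_succ (Finset.mem_range.1 hi)
        gcongr
        · exact hz' i (hi'.trans hm)
        · exact hcomp _ ((Nat.sub_le _ _).trans hm)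
    _ = 2 ^ m * B' * (s.factorial * B ^ s * D) := by
        rw [← Finset.sum_mul, ← Finset.sum_mul, ← Nat.cast_sum, Nat.sum_range_choose]
        push_cast
        ring
    _ ≤ 2 ^ s * B' * (s.factorial * B ^ s * D) := by
        gcongr
        norm_num
    _ = _ := by ring

/-- Continuous multilinear maps inject into the finite-dimensional space of all multilinear maps,
and finite-dimensional real normed spaces are proper. This makes the spaces of continuous functions
that receive the jets second countable. -/
instance secondCountableTopology_continuousMultilinearMap [FiniteDimensional ℝ E]
    [FiniteDimensional ℝ F] (m : ℕ) : SecondCountableTopology (E [×m]→L[ℝ] F) := by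
  have : FiniteDimensional ℝ (E [×m]→L[ℝ] F) := FiniteDimensional.of_injective
    (ContinuousMultilinearMap.toMultilinearMapLinear :
      (E [×m]→L[ℝ] F) →ₗ[ℝ] MultilinearMap ℝ (fun _ : Fin m => E) F)
    ContinuousMultilinearMap.toMultilinearMap_injective
  have := FiniteDimensional.proper ℝ (E [×m]→L[ℝ] F)
  infer_instance

end Limit

/-! ### Compactness in charts and uniform constants -/

/-- The projection is open, so `C` is covered by the images of finitely many compact subsets of the
source. The translates of their union under the finite group exhaust the preimage of `C`. -/
theorem OrbifoldChart.IsSmooth.exists_isCompact_preimage_subset {k : ℕ∞} {E X : Type*}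
    [NormedAddCommGroup E] [NormedSpace ℝ E] [LocallyCompactSpace E] [TopologicalSpace X]
    {c : OrbifoldChart E X} (h : c.IsSmooth k) {C : Set X} (hC : IsCompact C)
    (hCi : C ⊆ c.image) : ∃ Q ⊆ c.source, IsCompact Q ∧ c.source ∩ c.proj ⁻¹' C ⊆ Q := by
  have := h.finite
  obtain ⟨Q, hQs, hQ, hCQ⟩ : ∃ Q ⊆ c.source, IsCompact Q ∧ C ⊆ c.proj '' Q := by
    refine hC.induction_on (p := fun C => ∃ Q ⊆ c.source, IsCompact Q ∧ C ⊆ c.proj '' Q)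
      ⟨∅, by simp, isCompact_empty, by simp⟩ ?_ ?_ ?_
    · rintro s t hst ⟨Q, h1, h2, h3⟩
      exact ⟨Q, h1, h2, hst.trans h3⟩
    · rintro s t ⟨Q, h1, h2, h3⟩ ⟨Q', h1', h2', h3'⟩
      refine ⟨Q ∪ Q', union_subset h1 h1', h2.union h2', ?_⟩
      rw [image_union]
      exact union_subset_union h3 h3'
    · intro x hx
      obtain ⟨y, hy, rfl⟩ := hCi hx
      obtain ⟨Q, hQ, hyQ, hQs⟩ := exists_compact_subset h.isOpen_source hy
      refine ⟨c.proj '' interior Q, mem_nhdsWithin_of_mem_nhds ?_, Q, hQs, hQ,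
        image_mono interior_subset⟩
      exact (h.isOpen_proj_image _ (interior_subset.trans hQs) isOpen_interior).mem_nhds
        ⟨y, hyQ, rfl⟩
  refine ⟨⋃ γ, c.act γ '' Q, ?_, ?_, ?_⟩
  · rw [iUnion_subset_iff]
    rintro γ _ ⟨y, hy, rfl⟩
    exact h.act_mem γ y (hQs hy)
  · exact isCompact_iUnion fun γ => hQ.image_of_continuousOn ((h.continuousOn_act γ).mono hQs)
  · rintro y ⟨hy, hyC⟩
    obtain ⟨z, hz, hzy⟩ := hCQ hyC
    obtain ⟨γ, hγ⟩ := (h.proj_eq_iff z (hQs hz) y hy).1 hzy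
    exact mem_iUnion.2 ⟨γ, z, hz, hγ⟩

/-- Replaces finitely many constants by one. The hypotheses force `D` to be nonnegative, so that
enlarging the constant is harmless; the maximum with `1` keeps it positive even if `A` is empty. -/
theorem exists_pos_forall_le_mul {A : Type*} [Finite A] {M : A → ℝ} (hM : ∀ a, 0 < M a) :
    ∃ M' > 0, ∀ a x D, 0 ≤ x → x ≤ M a * D → x ≤ M' * D := by
  obtain ⟨M', h⟩ := Finite.exists_le M
  refine ⟨max 1 M', by positivity, fun a x D hx hxD => hxD.trans ?_⟩
  have hD : 0 ≤ D := nonneg_of_mul_nonneg_right (hx.trans hxD) (hM a)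
  gcongr
  exact (h a).trans (le_max_right _ _)

/-! ### A priori estimates across charts -/

namespace Orbifold

variable {n : ℕ} {r : ℕ∞} {X : Type u} [TopologicalSpace X] {O : Orbifold.{u, v} n (r + 1) X}

namespace Orbisection

/-- Coherence along `ψ⁻¹` gives `s_i(z) = d(ψ⁻¹)_{ψ z} (s_j(ψ z))` near `y`, and the estimate for `A
z (g (φ z))` applies with `A = dψ⁻¹ ∘ ψ`, `g = s_j` and `φ = ψ`. The constant depends on `ψ`, but
not on the orbisection. -/
theorem exists_transition_bound {i j : O.ι}
    {ψ : OpenPartialHomeomorph (EuclideanSpace ℝ (Fin n)) (EuclideanSpace ℝ (Fin n))}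
    (hψ : O.IsTransition i j ψ) {y : EuclideanSpace ℝ (Fin n)} (hy : y ∈ ψ.source) {s : ℕ}
    (hs : (s : ℕ∞) ≤ r) :
    ∃ M : ℝ, 0 < M ∧ ∀ᶠ z in 𝓝 y, ∀ (σ : O.Orbisection) (D : ℝ),
      (∀ m ≤ s, ‖iteratedFDeriv ℝ m (σ.field j) (ψ z)‖ ≤ D) →
      ∀ m ≤ s, ‖iteratedFDeriv ℝ m (σ.field i) z‖ ≤ M * D := by
  have hsr : (s : WithTop ℕ∞) ≤ (r : WithTop ℕ∞) := by exact_mod_cast hs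
  -- The coefficient `A` is a differential and costs one derivative; the class `C^{r+1}` of the
  -- orbifold supplies it.
  have hsr1 : (s : WithTop ℕ∞) + 1 ≤ ((r + 1 : ℕ∞) : WithTop ℕ∞) := by
    push_cast
    gcongr
  have hψs : ContDiffOn ℝ s ψ ψ.source := hψ.contDiffOn.of_le (le_self_add.trans hsr1)
  have hA : ContDiffOn ℝ s (fun z => fderiv ℝ ψ.symm (ψ z)) ψ.source :=
    (hψ.contDiffOn_symm.fderiv_of_isOpen ψ.open_target hsr1).comp hψs ψ.mapsTo
  obtain ⟨M, hM, h⟩ := exists_norm_iteratedFDerivWithin_clm_comp_le (G := EuclideanSpace ℝ (Fin n))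
    (H := EuclideanSpace ℝ (Fin n)) ψ.open_source ψ.open_target hψs ψ.mapsTo hA hy
  refine ⟨M, hM, ?_⟩
  filter_upwards [h, ψ.open_source.mem_nhds hy] with z hz hzs σ D hD m hm
  have h1 := hz (σ.field j) (((σ.contDiffOn_field j).of_le hsr).mono hψ.target_subset) D
    (fun m hm => by
      rw [iteratedFDerivWithin_of_isOpen m ψ.open_target (ψ.map_source hzs)]
      exact hD m hm) m hm
  rw [iteratedFDerivWithin_congr (f := σ.field i), iteratedFDerivWithin_of_isOpen m
    ψ.open_source hzs] at h1
  · exact h1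
  · intro w hw
    simp only
    rw [σ.fderiv_transition_field hψ.symm (ψ.map_source hw), ψ.left_inv hw]
  · exact hzs

/-- Every `z` near `y` lies over some `S a`, with `a` depending on `z`; each `a` is treated
separately and the finitely many constants are merged. The sets `S a` need not be closed, and the
compact sets `K a` exclude the charts that `y` does not meet. -/
theorem exists_nhds_bound [T2Space X] {A : Type*} [Finite A] {idx : A → O.ι}
    {S K : A → Set (EuclideanSpace ℝ (Fin n))} (hSK : ∀ a, S a ⊆ K a) (hK : ∀ a, IsCompact (K a))
    (hKs : ∀ a, K a ⊆ (O.chart (idx a)).source)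
    (hS : ⋃ a, (O.chart (idx a)).proj '' S a = univ) {j : O.ι} {y : EuclideanSpace ℝ (Fin n)}
    (hy : y ∈ (O.chart j).source) {s : ℕ} (hs : (s : ℕ∞) ≤ r) :
    ∃ M > 0, ∀ᶠ z in 𝓝 y, ∀ (σ : O.Orbisection) (D : ℝ),
      (∀ a, ∀ m ≤ s, ∀ w ∈ S a, ‖iteratedFDeriv ℝ m (σ.field (idx a)) w‖ ≤ D) →
      ∀ m ≤ s, ‖iteratedFDeriv ℝ m (σ.field j) z‖ ≤ M * D := by
  have key : ∀ a, ∃ M > 0, ∀ᶠ z in 𝓝 y, (O.chart j).proj z ∈ (O.chart (idx a)).proj '' S a →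
      ∀ (σ : O.Orbisection) (D : ℝ),
      (∀ m ≤ s, ∀ w ∈ S a, ‖iteratedFDeriv ℝ m (σ.field (idx a)) w‖ ≤ D) →
      ∀ m ≤ s, ‖iteratedFDeriv ℝ m (σ.field j) z‖ ≤ M * D := by
    intro a
    have ha := O.isSmooth (idx a)
    have := ha.finite
    have hc : ContinuousAt (O.chart j).proj y :=
      (O.isSmooth j).continuousOn_proj.continuousAt ((O.isSmooth j).isOpen_source.mem_nhds hy)
    -- Either a change of coordinates at `y` reaches the chart of `a`, or the image of `K a`, which
    -- is closed because `X` is Hausdorff, is avoided near `y` and there is nothing to prove.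
    by_cases hya : (O.chart j).proj y ∈ (O.chart (idx a)).proj '' K a
    · obtain ⟨w, hw, hwy⟩ := hya
      obtain ⟨ψ, hψ, hyψ, hψw⟩ := O.exists_transition le_add_self j (idx a) hy (hKs a hw) hwy.symm
      -- The point of `S a` over `z` need not be `ψ z`, but only some translate `γ (ψ z)`. The
      -- change of coordinates `ψ` followed by `γ` is therefore estimated for all of the finitely
      -- many `γ` beforehand.
      have hγ : ∀ γ : (O.chart (idx a)).Γ, ∃ M > 0, ∀ᶠ z in 𝓝 y, ∀ (σ : O.Orbisection) (D : ℝ),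
          (∀ m ≤ s, ‖iteratedFDeriv ℝ m (σ.field (idx a))
            ((O.chart (idx a)).act γ (ψ z))‖ ≤ D) →
          ∀ m ≤ s, ‖iteratedFDeriv ℝ m (σ.field j) z‖ ≤ M * D := by
        intro γ
        obtain ⟨φ, hφ, hφs, hφγ⟩ := O.exists_transition_act (idx a) γ
        obtain ⟨M, hM, h⟩ := exists_transition_bound (hψ.trans hφ) (y := y) (by
          rw [OpenPartialHomeomorph.trans_source]
          exact ⟨hyψ, by rw [mem_preimage, hφs]; exact hψ.target_subset (ψ.map_source hyψ)⟩) hs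
        simp only [OpenPartialHomeomorph.coe_trans, Function.comp_apply, hφγ] at h
        exact ⟨M, hM, h⟩
      choose M hM h using hγ
      obtain ⟨M', hM', hle⟩ := exists_pos_forall_le_mul hM
      refine ⟨M', hM', ?_⟩
      filter_upwards [eventually_all.2 h, ψ.open_source.mem_nhds hyψ]
        with z hz hzψ ⟨w, hw, hwz⟩ σ D hD m hm
      rw [← hψ.proj_eq z hzψ] at hwz
      obtain ⟨γ, hγ⟩ := (ha.proj_eq_iff _ (hψ.target_subset (ψ.map_source hzψ)) w
        (hKs a (hSK a hw))).1 hwz.symm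
      refine hle γ _ _ (norm_nonneg _) (hz γ σ D (fun m hm => ?_) m hm)
      rw [hγ]
      exact hD m hm w hw
    · have hcl : IsClosed ((O.chart (idx a)).proj '' K a) :=
        ((hK a).image_of_continuousOn (ha.continuousOn_proj.mono (hKs a))).isClosed
      refine ⟨1, one_pos, ?_⟩
      filter_upwards [hc.eventually_mem (hcl.isOpen_compl.mem_nhds hya)] with z hz hz'
      exact absurd (image_mono (hSK a) hz') hz
  choose M hM h using key
  obtain ⟨M', hM', hle⟩ := exists_pos_forall_le_mul hM
  refine ⟨M', hM', ?_⟩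
  filter_upwards [eventually_all.2 h] with z hz σ D hD m hm
  obtain ⟨a, ha⟩ := mem_iUnion.1 (hS ▸ mem_univ ((O.chart j).proj z) :
    (O.chart j).proj z ∈ ⋃ a, (O.chart (idx a)).proj '' S a)
  exact hle a _ _ (norm_nonneg _) (hz a ha σ D (hD a) m hm)

/-- The derivatives of an orbisection on a compact part of a chart are controlled by its
derivatives on sets that cover the orbifold. -/
theorem exists_bound [T2Space X] {A : Type*} [Finite A] {idx : A → O.ι}
    {S K : A → Set (EuclideanSpace ℝ (Fin n))} (hSK : ∀ a, S a ⊆ K a) (hK : ∀ a, IsCompact (K a))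
    (hKs : ∀ a, K a ⊆ (O.chart (idx a)).source)
    (hS : ⋃ a, (O.chart (idx a)).proj '' S a = univ) {j : O.ι}
    {L : Set (EuclideanSpace ℝ (Fin n))} (hL : IsCompact L) (hLs : L ⊆ (O.chart j).source) {s : ℕ}
    (hs : (s : ℕ∞) ≤ r) :
    ∃ M > 0, ∀ (σ : O.Orbisection) (D : ℝ),
      (∀ a, ∀ m ≤ s, ∀ w ∈ S a, ‖iteratedFDeriv ℝ m (σ.field (idx a)) w‖ ≤ D) →
      ∀ m ≤ s, ∀ z ∈ L, ‖iteratedFDeriv ℝ m (σ.field j) z‖ ≤ M * D := by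
  refine hL.induction_on (p := fun L => ∃ M > 0, ∀ (σ : O.Orbisection) (D : ℝ),
      (∀ a, ∀ m ≤ s, ∀ w ∈ S a, ‖iteratedFDeriv ℝ m (σ.field (idx a)) w‖ ≤ D) →
      ∀ m ≤ s, ∀ z ∈ L, ‖iteratedFDeriv ℝ m (σ.field j) z‖ ≤ M * D) ?_ ?_ ?_ ?_
  · exact ⟨1, one_pos, by simp⟩
  · rintro L L' hLL ⟨M, hM, h⟩
    exact ⟨M, hM, fun σ D hD m hm z hz => h σ D hD m hm z (hLL hz)⟩
  · rintro L L' ⟨M, hM, h⟩ ⟨M', hM', h'⟩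
    refine ⟨M + M', by positivity, fun σ D hD m hm z hz => ?_⟩
    rcases hz with hz | hz
    · have h1 := h σ D hD m hm z hz
      have hD0 : 0 ≤ D := nonneg_of_mul_nonneg_right ((norm_nonneg _).trans h1) hM
      exact h1.trans (by gcongr; linarith)
    · have h1 := h' σ D hD m hm z hz
      have hD0 : 0 ≤ D := nonneg_of_mul_nonneg_right ((norm_nonneg _).trans h1) hM'
      exact h1.trans (by gcongr; linarith)
  · intro y hy
    obtain ⟨M, hM, h⟩ := exists_nhds_bound hSK hK hKs hS (hLs hy) hs
    exact ⟨_, mem_nhdsWithin_of_mem_nhds h, M, hM, fun σ D hD m hm z hz => hz σ D hD m hm⟩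

theorem contDiffAt_field (σ : O.Orbisection) {i : O.ι} {y : EuclideanSpace ℝ (Fin n)}
    (hy : y ∈ (O.chart i).source) : ContDiffAt ℝ r (σ.field i) y :=
  (σ.contDiffOn_field i).contDiffAt ((O.isSmooth i).isOpen_source.mem_nhds hy)

theorem iteratedFDeriv_field_add (σ τ : O.Orbisection) {i : O.ι} {y : EuclideanSpace ℝ (Fin n)}
    (hy : y ∈ (O.chart i).source) {m : ℕ} (hm : (m : ℕ∞) ≤ r) :
    iteratedFDeriv ℝ m ((σ + τ).field i) y =
      iteratedFDeriv ℝ m (σ.field i) y + iteratedFDeriv ℝ m (τ.field i) y := by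
  have hm' : (m : WithTop ℕ∞) ≤ (r : WithTop ℕ∞) := by exact_mod_cast hm
  rw [← iteratedFDeriv_add_apply ((σ.contDiffAt_field hy).of_le hm')
    ((τ.contDiffAt_field hy).of_le hm')]
  refine (EventuallyEq.iteratedFDeriv ℝ ?_ m).self_of_nhds
  filter_upwards [(O.isSmooth i).isOpen_source.mem_nhds hy] with z hz
    using field_add σ τ hz

theorem iteratedFDeriv_field_smul (c : ℝ) (σ : O.Orbisection) {i : O.ι}
    {y : EuclideanSpace ℝ (Fin n)} (hy : y ∈ (O.chart i).source) {m : ℕ} (hm : (m : ℕ∞) ≤ r) :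
    iteratedFDeriv ℝ m ((c • σ).field i) y = c • iteratedFDeriv ℝ m (σ.field i) y := by
  have hm' : (m : WithTop ℕ∞) ≤ (r : WithTop ℕ∞) := by exact_mod_cast hm
  rw [← iteratedFDeriv_const_smul_apply ((σ.contDiffAt_field hy).of_le hm')]
  refine (EventuallyEq.iteratedFDeriv ℝ ?_ m).self_of_nhds
  filter_upwards [(O.isSmooth i).isOpen_source.mem_nhds hy] with z hz
    using field_smul σ c hz

theorem iteratedFDeriv_field_sub (σ τ : O.Orbisection) {i : O.ι} {y : EuclideanSpace ℝ (Fin n)}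
    (hy : y ∈ (O.chart i).source) {m : ℕ} (hm : (m : ℕ∞) ≤ r) :
    iteratedFDeriv ℝ m ((σ - τ).field i) y =
      iteratedFDeriv ℝ m (σ.field i) y - iteratedFDeriv ℝ m (τ.field i) y := by
  rw [eq_sub_iff_add_eq, ← iteratedFDeriv_field_add _ _ hy hm, sub_add_cancel]

theorem continuousOn_iteratedFDeriv_field (σ : O.Orbisection) (i : O.ι) {m : ℕ}
    (hm : (m : ℕ∞) ≤ r) : ContinuousOn (iteratedFDeriv ℝ m (σ.field i)) (O.chart i).source :=
  ((σ.contDiffOn_field i).continuousOn_iteratedFDerivWithin (by exact_mod_cast hm)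
    (O.isSmooth i).isOpen_source.uniqueDiffOn).congr
    fun _ hy => (iteratedFDerivWithin_of_isOpen m (O.isSmooth i).isOpen_source hy).symm

end Orbisection

end Orbifold

/-! ### The jet map as a closed embedding -/

namespace Orbifold

variable {n : ℕ} {r : ℕ∞} {X : Type u} [TopologicalSpace X] {O : Orbifold.{u, v} n (r + 1) X}

namespace Orbisection

variable {A : Type} {idx : A → O.ι} {K : A → Set (EuclideanSpace ℝ (Fin n))}

/-- The derivatives of order at most `r` of the lifts of an orbisection on the sets `K a`. -/
noncomputable def jet (hKs : ∀ a, K a ⊆ (O.chart (idx a)).source) :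
    O.Orbisection →ₗ[ℝ] (a : A) → (m : {m : ℕ // (m : ℕ∞) ≤ r}) →
      C(K a, EuclideanSpace ℝ (Fin n) [×m.1]→L[ℝ] EuclideanSpace ℝ (Fin n)) where
  toFun σ a m := ⟨fun y => iteratedFDeriv ℝ m (σ.field (idx a)) y,
    continuousOn_iff_continuous_domRestrict.1
      ((σ.continuousOn_iteratedFDeriv_field (idx a) m.2).mono (hKs a))⟩
  map_add' σ τ := by
    ext1 a; ext1 m; ext1 y
    exact iteratedFDeriv_field_add σ τ (hKs a y.2) m.2
  map_smul' c σ := by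
    ext1 a; ext1 m; ext1 y
    exact iteratedFDeriv_field_smul c σ (hKs a y.2) m.2

theorem jet_apply (hKs : ∀ a, K a ⊆ (O.chart (idx a)).source) (σ : O.Orbisection) (a : A)
    (m : {m : ℕ // (m : ℕ∞) ≤ r}) (y : K a) :
    jet hKs σ a m y = iteratedFDeriv ℝ m (σ.field (idx a)) y := rfl

variable [Finite A] [∀ a, CompactSpace (K a)] [T2Space X]

/-- Closeness of the derivatives on the sets `K a` implies closeness on a compact part of any
chart. -/
theorem exists_dist_jet_bound (hKs : ∀ a, K a ⊆ (O.chart (idx a)).source)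
    (hK : ⋃ a, (O.chart (idx a)).proj '' K a = univ) {j : O.ι}
    {L : Set (EuclideanSpace ℝ (Fin n))} (hL : IsCompact L) (hLs : L ⊆ (O.chart j).source) {s : ℕ}
    (hs : (s : ℕ∞) ≤ r) :
    ∃ M > 0, ∀ (σ τ : O.Orbisection) (D : ℝ),
      (∀ a (m : {m : ℕ // (m : ℕ∞) ≤ r}), m.1 ≤ s → dist (jet hKs σ a m) (jet hKs τ a m) ≤ D) →
      ∀ m ≤ s, ∀ z ∈ L,
        ‖iteratedFDeriv ℝ m (σ.field j) z - iteratedFDeriv ℝ m (τ.field j) z‖ ≤ M * D := by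
  obtain ⟨M, hM, h⟩ := exists_bound (S := K) (fun a => Subset.rfl)
    (fun a => isCompact_iff_compactSpace.2 inferInstance) hKs hK hL hLs hs
  refine ⟨M, hM, fun σ τ D hD m hm z hz => ?_⟩
  have hmr : ∀ m ≤ s, (m : ℕ∞) ≤ r := fun m hm => le_trans (by exact_mod_cast hm) hs
  rw [← iteratedFDeriv_field_sub _ _ (hLs hz) (hmr m hm)]
  refine h (σ - τ) D (fun a m hm w hw => ?_) m hm z hz
  rw [iteratedFDeriv_field_sub _ _ (hKs a hw) (hmr m hm), ← dist_eq_norm]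
  exact (ContinuousMap.dist_apply_le_dist (f := jet hKs σ a ⟨m, hmr m hm⟩)
    (g := jet hKs τ a ⟨m, hmr m hm⟩) ⟨w, hw⟩).trans (hD a ⟨m, hmr m hm⟩ hm)

/-- Equal jets allow the estimate to be used with `D = 0` and `s = 0` at a single point of an
arbitrary chart. -/
theorem jet_injective (hKs : ∀ a, K a ⊆ (O.chart (idx a)).source)
    (hK : ⋃ a, (O.chart (idx a)).proj '' K a = univ) : Function.Injective (jet hKs) := by
  intro σ τ hστ
  refine ext_field fun i y hy => ?_
  obtain ⟨M, -, h⟩ := exists_dist_jet_bound hKs hK isCompact_singleton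
    (singleton_subset_iff.2 hy) (s := 0) (by simp)
  have h0 := h σ τ 0 (by simp [hστ]) 0 le_rfl y rfl
  rw [mul_zero, norm_le_zero_iff, sub_eq_zero] at h0
  simpa using congrArg (fun p => p 0) h0

/-- Sequences suffice, since the target is a countable product of metric spaces. Convergence of the
jets on the sets `K a` spreads by the a priori estimate to every chart, where a `C^r` limit exists;
the limits glue to an orbisection with the required jet. -/
theorem isClosed_range_jet (hKs : ∀ a, K a ⊆ (O.chart (idx a)).source)
    (hK : ⋃ a, (O.chart (idx a)).proj '' K a = univ) : IsClosed (range (jet hKs)) := by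
  refine IsSeqClosed.isClosed fun x p hx hp => ?_
  choose σ hσ using hx
  have hlim : ∀ a m, Tendsto (fun k => jet hKs (σ k) a m) atTop (𝓝 (p a m)) := fun a m => by
    simp only [hσ]
    exact tendsto_pi_nhds.1 (tendsto_pi_nhds.1 hp a) m
  have hg : ∀ j, ∃ g : EuclideanSpace ℝ (Fin n) → EuclideanSpace ℝ (Fin n),
      ContDiffOn ℝ r g (O.chart j).source ∧ ∀ m : ℕ, (m : ℕ∞) ≤ r → ∀ y ∈ (O.chart j).source,
        Tendsto (fun k => iteratedFDerivWithin ℝ m ((σ k).field j) (O.chart j).source y) atTop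
          (𝓝 (iteratedFDerivWithin ℝ m g (O.chart j).source y)) := by
    intro j
    have hj := (O.isSmooth j).isOpen_source
    refine exists_contDiffOn_of_uniformCauchySeqOn hj (fun k => (σ k).contDiffOn_field j) ?_
    intro s hs y hy
    obtain ⟨L, hL, hyL, hLs⟩ := exists_compact_subset hj hy
    refine ⟨L, mem_interior_iff_mem_nhds.1 hyL, ?_⟩
    obtain ⟨M, hM, hb⟩ := exists_dist_jet_bound hKs hK hL hLs hs
    rw [Metric.uniformCauchySeqOn_iff]
    intro ε hε
    have hfin : Finite {m : {m : ℕ // (m : ℕ∞) ≤ r} // m.1 ≤ s} :=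
      Finite.of_injective (fun m => (⟨m.1.1, Nat.lt_succ_of_le m.2⟩ : Fin (s + 1)))
        fun m m' h => Subtype.ext (Subtype.ext (congrArg Fin.val h))
    -- Only finitely many pairs of a set and an order at most `s` enter, so a common index exists.
    -- The tolerance `ε / (2 * M)` becomes `ε / 2`, which leaves room for a strict inequality.
    have hc : ∀ q : A × {m : {m : ℕ // (m : ℕ∞) ≤ r} // m.1 ≤ s}, ∃ N, ∀ k ≥ N, ∀ l ≥ N,
        dist (jet hKs (σ k) q.1 q.2.1) (jet hKs (σ l) q.1 q.2.1) < ε / (2 * M) := fun q =>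
      Metric.cauchySeq_iff.1 (hlim q.1 q.2.1).cauchySeq _ (by positivity)
    choose N hN using hc
    obtain ⟨N', hN'⟩ := Finite.exists_le N
    refine ⟨N', fun k hk l hl z hz => ?_⟩
    rw [dist_eq_norm, iteratedFDerivWithin_of_isOpen s hj (hLs hz),
      iteratedFDerivWithin_of_isOpen s hj (hLs hz)]
    refine (hb (σ k) (σ l) (ε / (2 * M)) (fun a m hm => ?_) s le_rfl z hz).trans_lt ?_
    · exact (hN (a, ⟨m, hm⟩) k ((hN' _).trans hk) l ((hN' _).trans hl)).le
    · rw [← mul_div_assoc, div_lt_iff₀ (by positivity)]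
      nlinarith
  choose g hgc hgt using hg
  have hpt : ∀ j, ∀ y ∈ (O.chart j).source,
      Tendsto (fun k => (σ k).field j y) atTop (𝓝 (g j y)) := by
    intro j y hy
    have h := (continuousMultilinearCurryFin0 ℝ (EuclideanSpace ℝ (Fin n))
      (EuclideanSpace ℝ (Fin n))).continuous.tendsto _ |>.comp (hgt j 0 (by simp) y hy)
    simpa [Function.comp_def] using h
  -- At a fixed point coherence is an identity involving one continuous linear map, so it passes to
  -- pointwise limits.
  have hcoh : IsCoherent (O := O) g := by
    refine ⟨hgc, fun i j ψ hψ y hy => ?_⟩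
    have h1 := ((fderiv ℝ ψ y).continuous.tendsto _).comp (hpt i y (hψ.source_subset hy))
    refine tendsto_nhds_unique h1 ?_
    simp only [Function.comp_def, (σ _).fderiv_transition_field hψ hy]
    exact hpt j _ (hψ.target_subset (ψ.map_source hy))
  refine ⟨glue g hcoh, ?_⟩
  ext1 a; ext1 m; ext1 y
  have hj := (O.isSmooth (idx a)).isOpen_source
  have hy := hKs a y.2
  have h1 : Tendsto (fun k => jet hKs (σ k) a m y) atTop (𝓝 (p a m y)) :=
    ((continuous_eval_const y).tendsto _).comp (hlim a m)
  refine tendsto_nhds_unique ?_ h1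
  have h2 := hgt (idx a) m m.2 y hy
  simp only [iteratedFDerivWithin_of_isOpen m.1 hj hy] at h2
  simp only [jet_apply]
  convert h2 using 2
  refine (EventuallyEq.iteratedFDeriv ℝ ?_ m).self_of_nhds
  filter_upwards [hj.mem_nhds hy] with z hz using field_glue hcoh hz

/-- The a priori estimate is used in both directions: from the sets `K a` to compact sets `Q a`
containing the preimages of the members of the cover, and from these preimages back to the sets `K
a`. -/
theorem crTopology_eq_induced_jet (𝒞 : O.Cover) (hKs : ∀ a, K a ⊆ (O.chart (idx a)).source)
    (hK : ⋃ a, (O.chart (idx a)).proj '' K a = univ) :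
    𝒞.crTopology = TopologicalSpace.induced (jet hKs) inferInstance := by
  have hQ : ∀ a, ∃ Q ⊆ (O.chart (𝒞.idx a)).source, IsCompact Q ∧
      (O.chart (𝒞.idx a)).source ∩ (O.chart (𝒞.idx a)).proj ⁻¹' 𝒞.C a ⊆ Q := by
    intro a
    obtain ⟨Q, h1, h2, h3⟩ := (O.isSmooth (𝒞.idx a)).exists_isCompact_preimage_subset
      (𝒞.isCompact_closure a) (𝒞.closure_subset a)
    exact ⟨Q, h1, h2, (inter_subset_inter_right _ (preimage_mono subset_closure)).trans h3⟩
  choose Q hQs hQ hCQ using hQ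
  have hcov : ⋃ a, (O.chart (𝒞.idx a)).proj ''
      ((O.chart (𝒞.idx a)).source ∩ (O.chart (𝒞.idx a)).proj ⁻¹' 𝒞.C a) = univ := by
    rw [← 𝒞.iUnion_eq]
    refine iUnion_congr fun a => ?_
    rw [image_inter_preimage]
    exact inter_eq_right.2 (subset_closure.trans (𝒞.closure_subset a))
  refine topologyOfNhds_eq_induced (Z := fun a m => C(K a, EuclideanSpace ℝ (Fin n) [×m.1]→L[ℝ]
    EuclideanSpace ℝ (Fin n))) _ (jet hKs) ?_ ?_
  · intro s hs ε hε
    have h := fun a => exists_dist_jet_bound hKs hK (hQ a) (hQs a) hs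
    choose M hM h using h
    obtain ⟨M', hM', hle⟩ := exists_pos_forall_le_mul hM
    refine ⟨ε / (2 * M'), by positivity, fun σ τ hd a m hm y hy hyC => ?_⟩
    refine (hle a _ _ (norm_nonneg _) (h a σ τ (ε / (2 * M')) (fun b l hl => ?_) m hm y
      (hCQ a ⟨hy, hyC⟩))).trans_lt ?_
    · rw [dist_comm]
      exact (hd b l hl).le
    · rw [← mul_div_assoc, div_lt_iff₀ (by positivity)]
      nlinarith
  · intro s hs ε hε
    -- The preimages of the open sets `𝒞.C a` are not compact; they play the role of `S`, and the
    -- sets `Q a` that of `K`.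
    have h := fun a => exists_bound hCQ hQ hQs hcov (isCompact_iff_compactSpace.2
      (inferInstance : CompactSpace (K a))) (hKs a) hs
    choose M hM h using h
    obtain ⟨M', hM', hle⟩ := exists_pos_forall_le_mul hM
    refine ⟨ε / (2 * M'), by positivity, fun σ τ hτ a m hm => ?_⟩
    have hmr : ∀ m ≤ s, (m : ℕ∞) ≤ r := fun m hm => le_trans (by exact_mod_cast hm) hs
    -- Pointwise bounds give only a weak inequality for the supremum, hence the bound `ε / 2`.
    refine lt_of_le_of_lt ((ContinuousMap.dist_le (half_pos hε).le).2 fun y => ?_)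
      (half_lt_self hε)
    rw [dist_comm, dist_eq_norm, jet_apply, jet_apply,
      ← iteratedFDeriv_field_sub _ _ (hKs a y.2) m.2]
    refine (hle a _ _ (norm_nonneg _) (h a (σ - τ) (ε / (2 * M')) (fun b l hl w hw => ?_) m hm y
      y.2)).trans_eq ?_
    · rw [iteratedFDeriv_field_sub _ _ hw.1 (hmr l hl)]
      exact (hτ b l hl w hw.1 hw.2).le
    · field_simp

/-- With the `C^r` topology the derivatives identify the space of orbisections with a closed
subspace of a product of spaces of continuous functions. -/
theorem isClosedEmbedding_jet (𝒞 : O.Cover) (hKs : ∀ a, K a ⊆ (O.chart (idx a)).source)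
    (hK : ⋃ a, (O.chart (idx a)).proj '' K a = univ) :
    letI : TopologicalSpace O.Orbisection := 𝒞.crTopology
    IsClosedEmbedding (jet hKs) := by
  let _ : TopologicalSpace O.Orbisection := 𝒞.crTopology
  exact ⟨⟨⟨crTopology_eq_induced_jet 𝒞 hKs hK⟩, jet_injective hKs hK⟩, isClosed_range_jet hKs hK⟩

end Orbisection

end Orbifold

/-! ### Closed subspaces of products of spaces of continuous functions -/

section Pi

variable {V : Type u} [AddCommGroup V] [Module ℝ V] [TopologicalSpace V] {A B : Type}
  {K : A → Type} [∀ a, TopologicalSpace (K a)] [∀ a, CompactSpace (K a)]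
  [∀ a, SecondCountableTopology (K a)] [∀ a, LocallyCompactSpace (K a)]
  {G : B → Type} [∀ b, NormedAddCommGroup (G b)] [∀ b, NormedSpace ℝ (G b)]
  [∀ b, CompleteSpace (G b)] [∀ b, SecondCountableTopology (G b)]
  {J : V →ₗ[ℝ] (a : A) → (b : B) → C(K a, G b)}

theorem isSeparableBanachSpace_of_isClosedEmbedding_pi [Finite A] [Finite B]
    (hJ : IsClosedEmbedding J) : IsSeparableBanachSpace V := by
  let _ : Fintype A := Fintype.ofFinite A
  let _ : Fintype B := Fintype.ofFinite B
  exact isSeparableBanachSpace_of_isClosedEmbedding (W := (a : A) → (b : B) → C(K a, G b)) J hJ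

/-- With infinitely many orders of derivatives the product carries no supremum norm. It is still
complete and locally convex, and it is metrizable because it is regular, Hausdorff and second
countable. -/
theorem isSeparableFrechetSpace_of_isClosedEmbedding_pi [Countable A] [Countable B]
    (hJ : IsClosedEmbedding J) : IsSeparableFrechetSpace V := by
  have : TopologicalSpace.MetrizableSpace ((a : A) → (b : B) → C(K a, G b)) :=
    TopologicalSpace.metrizableSpace_of_t3_secondCountable _
  exact isSeparableFrechetSpace_of_isClosedEmbedding
    (W := (a : A) → (b : B) → C(K a, G b)) J hJ

end Pi

/-! ### The jet map on `C^r(K, F)` -/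

namespace CrSpace

variable {E F : Type*} [NormedAddCommGroup E] [NormedSpace ℝ E]
  [NormedAddCommGroup F] [NormedSpace ℝ F] {r : ℕ∞} {K : Set E}

theorem contDiffOn_val (f : CrSpace F r K) : ContDiffOn ℝ r f.val K := f.2

/-- The element of `C^r(K, F)` that is the restriction of `f`. -/
def restrict (K : Set E) (f : E → F) (hf : ContDiffOn ℝ r f K) : CrSpace F r K :=
  ⟨fun y => f y, hf.congr fun y hy =>
    Subtype.val_injective.extend_apply (fun y : K => f y) 0 ⟨y, hy⟩⟩

theorem restrict_val {f : E → F} (hf : ContDiffOn ℝ r f K) {y : E} (hy : y ∈ K) :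
    (restrict K f hf).val y = f y :=
  Subtype.val_injective.extend_apply (fun y : K => f y) 0 ⟨y, hy⟩

theorem ext_val {f g : CrSpace F r K} (h : ∀ y ∈ K, f.val y = g.val y) : f = g := by
  refine Subtype.ext (funext fun y => ?_)
  have h1 : ∀ φ : CrSpace F r K, φ.val y = φ.1 y := fun φ =>
    Subtype.val_injective.extend_apply φ.1 0 y
  rw [← h1, ← h1, h y y.2]

theorem add_val (f g : CrSpace F r K) {y : E} (hy : y ∈ K) :
    (f + g).val y = f.val y + g.val y := by
  have h1 : ∀ φ : CrSpace F r K, φ.val y = φ.1 ⟨y, hy⟩ := fun φ =>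
    Subtype.val_injective.extend_apply φ.1 0 ⟨y, hy⟩
  rw [h1, h1, h1]
  rfl

theorem smul_val (c : ℝ) (f : CrSpace F r K) {y : E} (hy : y ∈ K) :
    (c • f).val y = c • f.val y := by
  have h1 : ∀ φ : CrSpace F r K, φ.val y = φ.1 ⟨y, hy⟩ := fun φ =>
    Subtype.val_injective.extend_apply φ.1 0 ⟨y, hy⟩
  rw [h1, h1]
  rfl

/-- The derivatives of an element of `C^r(K, F)`. -/
noncomputable def jet (hK : UniqueDiffOn ℝ K) (f : CrSpace F r K)
    (m : {m : ℕ // (m : ℕ∞) ≤ r}) : C(K, E [×m.1]→L[ℝ] F) :=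
  ⟨fun y => iteratedFDerivWithin ℝ m f.val K y, continuousOn_iff_continuous_domRestrict.1
    (f.contDiffOn_val.continuousOn_iteratedFDerivWithin (by exact_mod_cast m.2) hK)⟩

theorem jet_apply (hK : UniqueDiffOn ℝ K) (f : CrSpace F r K) (m : {m : ℕ // (m : ℕ∞) ≤ r})
    (y : K) : jet hK f m y = iteratedFDerivWithin ℝ m f.val K y := rfl

theorem jet_injective (hK : UniqueDiffOn ℝ K) :
    Function.Injective (jet hK : CrSpace F r K → _) := by
  intro f g hfg
  refine ext_val fun y hy => ?_
  have h : iteratedFDerivWithin ℝ 0 f.val K y = iteratedFDerivWithin ℝ 0 g.val K y :=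
    DFunLike.congr_fun (congrFun hfg ⟨0, by simp⟩) (⟨y, hy⟩ : K)
  simpa using congrArg (fun p => p 0) h

/-- On compact `K` the basic neighborhoods are, up to a factor `2` in `ε`, conditions on the
supremum distances of the derivatives. -/
theorem isInducing_jet [CompactSpace K] (hK : UniqueDiffOn ℝ K) :
    IsInducing (jet hK : CrSpace F r K → _) := by
  -- A one-point index set brings the map into the form of the comparison lemma; it is removed at
  -- the end.
  have h1 : IsInducing fun (f : CrSpace F r K) (_ : Unit) => jet hK f := by
    refine ⟨topologyOfNhds_eq_induced (N := CrSpace.nhd)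
      (Z := fun _ m => C(K, E [×m.1]→L[ℝ] F))
      (fun _ _ _ _ _ hs hε _ h m hm y hy => (h m (hm.trans hs) y hy).trans_le hε)
      (fun (f : CrSpace F r K) (_ : Unit) => jet hK f) ?_ ?_⟩
    · intro s hs ε hε
      refine ⟨ε, hε, fun f g h m hm y hy => ?_⟩
      have hmr : (m : ℕ∞) ≤ r := le_trans (by exact_mod_cast hm) hs
      rw [← dist_eq_norm, dist_comm]
      exact (ContinuousMap.dist_apply_le_dist (f := jet hK g ⟨m, hmr⟩)
        (g := jet hK f ⟨m, hmr⟩) ⟨y, hy⟩).trans_lt (h () ⟨m, hmr⟩ hm)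
    · intro s hs ε hε
      refine ⟨ε / 2, half_pos hε, fun f g h _ m hm => ?_⟩
      refine lt_of_le_of_lt ((ContinuousMap.dist_le (half_pos hε).le).2 fun y => ?_)
        (half_lt_self hε)
      rw [dist_comm, dist_eq_norm]
      exact (h m hm y y.2).le
  exact (Homeomorph.funUnique Unit _).isInducing.comp h1

end CrSpace

/-! ### Restriction of orbisections to compact sets in charts -/

namespace Orbifold

variable {n : ℕ} {r : ℕ∞} {X : Type u} [TopologicalSpace X] {O : Orbifold.{u, v} n (r + 1) X}

namespace Orbisection

variable {A : Type} {idx : A → O.ι} {K : A → Set (EuclideanSpace ℝ (Fin n))}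

/-- Restriction of the lifts of an orbisection to the sets `K a`. -/
noncomputable def restrict (hKs : ∀ a, K a ⊆ (O.chart (idx a)).source) :
    O.Orbisection →ₗ[ℝ] (a : A) → CrSpace (EuclideanSpace ℝ (Fin n)) r (K a) where
  toFun σ a := CrSpace.restrict (K a) (σ.field (idx a)) ((σ.contDiffOn_field (idx a)).mono (hKs a))
  map_add' σ τ := by
    ext1 a
    refine CrSpace.ext_val fun y hy => ?_
    rw [Pi.add_apply, CrSpace.add_val _ _ hy, CrSpace.restrict_val _ hy, CrSpace.restrict_val _ hy,
      CrSpace.restrict_val _ hy, field_add _ _ (hKs a hy)]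
  map_smul' c σ := by
    ext1 a
    refine CrSpace.ext_val fun y hy => ?_
    rw [Pi.smul_apply, CrSpace.smul_val _ _ hy, CrSpace.restrict_val _ hy,
      CrSpace.restrict_val _ hy, field_smul _ _ (hKs a hy), RingHom.id_apply]

theorem restrict_val (hKs : ∀ a, K a ⊆ (O.chart (idx a)).source) (σ : O.Orbisection) (a : A)
    {y : EuclideanSpace ℝ (Fin n)} (hy : y ∈ K a) :
    (restrict hKs σ a).val y = σ.field (idx a) y :=
  CrSpace.restrict_val ((σ.contDiffOn_field (idx a)).mono (hKs a)) hy

/-- The lifts are `C^r` on an open neighborhood of `K a`, so derivatives within `K a`, being unique,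
are the full derivatives. -/
theorem jet_restrict (hKs : ∀ a, K a ⊆ (O.chart (idx a)).source)
    (hKu : ∀ a, UniqueDiffOn ℝ (K a)) (σ : O.Orbisection) (a : A) :
    CrSpace.jet (hKu a) (restrict hKs σ a) = jet hKs σ a := by
  ext1 m; ext1 y
  rw [CrSpace.jet_apply, jet_apply,
    iteratedFDerivWithin_congr (fun z hz => restrict_val hKs σ a hz) y.2]
  exact iteratedFDerivWithin_eq_iteratedFDeriv (hKu a)
    ((σ.contDiffAt_field (hKs a y.2)).of_le (by exact_mod_cast m.2)) y.2

/-- The jet map is `G ∘ restrict` with `G` the embedding by derivatives within the sets `K a`. The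
first factor of a composite embedding is an embedding, and its range is the preimage under `G` of
the closed range of the composite. -/
theorem isClosedEmbedding_restrict [Finite A] [∀ a, CompactSpace (K a)] [T2Space X] (𝒞 : O.Cover)
    (hKs : ∀ a, K a ⊆ (O.chart (idx a)).source)
    (hK : ⋃ a, (O.chart (idx a)).proj '' K a = univ) (hKu : ∀ a, UniqueDiffOn ℝ (K a)) :
    letI : TopologicalSpace O.Orbisection := 𝒞.crTopology
    IsClosedEmbedding (restrict hKs) := by
  let _ : TopologicalSpace O.Orbisection := 𝒞.crTopology
  have hJ := isClosedEmbedding_jet 𝒞 hKs hK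
  let G : ((a : A) → CrSpace (EuclideanSpace ℝ (Fin n)) r (K a)) → (a : A) →
      (m : {m : ℕ // (m : ℕ∞) ≤ r}) →
      C(K a, EuclideanSpace ℝ (Fin n) [×m.1]→L[ℝ] EuclideanSpace ℝ (Fin n)) :=
    fun f a => CrSpace.jet (hKu a) (f a)
  have hG : IsEmbedding G :=
    ⟨IsInducing.piMap fun a => CrSpace.isInducing_jet (hKu a),
      Function.Injective.piMap fun a => CrSpace.jet_injective (hKu a)⟩
  have hcomp : (fun σ => jet hKs σ) = G ∘ restrict hKs := by
    ext1 σ; ext1 a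
    exact (jet_restrict hKs hKu σ a).symm
  replace hJ : IsClosedEmbedding (G ∘ restrict hKs) := hcomp ▸ hJ
  refine ⟨(hG.of_comp_iff).1 hJ.isEmbedding, ?_⟩
  have := hJ.isClosed_range.preimage hG.continuous
  rwa [range_comp, preimage_image_eq _ hG.injective] at this

theorem isSeparableBanachSpace [Finite A] [∀ a, CompactSpace (K a)] [T2Space X] (𝒞 : O.Cover)
    (hKs : ∀ a, K a ⊆ (O.chart (idx a)).source)
    (hK : ⋃ a, (O.chart (idx a)).proj '' K a = univ) (hr : r < ⊤) :
    letI : TopologicalSpace O.Orbisection := 𝒞.crTopology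
    IsSeparableBanachSpace O.Orbisection := by
  let _ : TopologicalSpace O.Orbisection := 𝒞.crTopology
  have : Finite {m : ℕ // (m : ℕ∞) ≤ r} := by
    lift r to ℕ using hr.ne
    refine Set.Finite.subset (finite_Iic r) fun m hm => ?_
    exact_mod_cast (show (m : ℕ∞) ≤ r from hm)
  exact isSeparableBanachSpace_of_isClosedEmbedding_pi 
    (G := fun m : {m : ℕ // (m : ℕ∞) ≤ r} =>
      EuclideanSpace ℝ (Fin n) [×m.1]→L[ℝ] EuclideanSpace ℝ (Fin n))
    (J := jet hKs) (isClosedEmbedding_jet 𝒞 hKs hK)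

theorem isSeparableFrechetSpace [Finite A] [∀ a, CompactSpace (K a)] [T2Space X] (𝒞 : O.Cover)
    (hKs : ∀ a, K a ⊆ (O.chart (idx a)).source)
    (hK : ⋃ a, (O.chart (idx a)).proj '' K a = univ) :
    letI : TopologicalSpace O.Orbisection := 𝒞.crTopology
    IsSeparableFrechetSpace O.Orbisection := by
  let _ : TopologicalSpace O.Orbisection := 𝒞.crTopology
  exact isSeparableFrechetSpace_of_isClosedEmbedding_pi 
    (G := fun m : {m : ℕ // (m : ℕ∞) ≤ r} =>
      EuclideanSpace ℝ (Fin n) [×m.1]→L[ℝ] EuclideanSpace ℝ (Fin n))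
    (J := jet hKs) (isClosedEmbedding_jet 𝒞 hKs hK)

end Orbisection

/-! ### Finite covers by balls, and the theorem -/

/-- A compact orbifold is covered by finitely many balls in charts. -/
theorem exists_finite_cover_balls [CompactSpace X] (O : Orbifold.{u, v} n (r + 1) X) :
    ∃ (N : ℕ) (i : Fin N → O.ι) (ρ : Fin N → ℝ),
      (∀ a, 0 < ρ a ∧ Metric.closedBall 0 (ρ a) ⊆ (O.chart (i a)).source) ∧
      (⋃ a, (O.chart (i a)).proj '' Metric.ball 0 (ρ a)) = univ := by
  have h : ∀ x : X, ∃ (i : O.ι) (ρ : ℝ), 0 < ρ ∧ Metric.closedBall 0 ρ ⊆ (O.chart i).source ∧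
      (O.chart i).proj '' Metric.ball 0 ρ ∈ 𝓝 x := by
    intro x
    obtain ⟨i, hi, -⟩ := O.exists_chart x univ univ_mem
    have hs := O.isSmooth i
    obtain ⟨ρ, hρ, hsub⟩ := Metric.nhds_basis_closedBall.mem_iff.1
      (hs.isOpen_source.mem_nhds hs.zero_mem)
    exact ⟨i, ρ, hρ, hsub, (hs.isOpen_proj_image _ (Metric.ball_subset_closedBall.trans hsub)
      Metric.isOpen_ball).mem_nhds ⟨0, Metric.mem_ball_self hρ, hi⟩⟩
  choose i ρ hρ hsub hnhds using h
  obtain ⟨t, ht⟩ := CompactSpace.elim_nhds_subcover _ hnhds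
  refine ⟨t.card, fun a => i (t.equivFin.symm a), fun a => ρ (t.equivFin.symm a),
    fun a => ⟨hρ _, hsub _⟩, eq_univ_of_forall fun x => ?_⟩
  obtain ⟨z, hz, hxz⟩ := mem_iUnion₂.1 (ht ▸ mem_univ x :
    x ∈ ⋃ z ∈ t, (O.chart (i z)).proj '' Metric.ball 0 (ρ z))
  refine mem_iUnion.2 ⟨t.equivFin ⟨z, hz⟩, ?_⟩
  simpa using hxz

end Orbifold

/-- Let `O` be a compact orbifold of class `C^{r+1}`, `1 ≤ r ≤ ∞`, and let the space of `C^r`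
orbisections of its tangent orbibundle carry the `C^r` topology. It is a separable Banach space
if `r < ∞` and a separable Fréchet space if `r = ∞`, and restriction of the local lifts to
suitable closed balls in finitely many charts identifies it, linearly and homeomorphically, with a
closed subspace of the direct sum of the spaces of `C^r` maps from these balls to `ℝ^n`. -/
theorem mainTheorem5 {n : ℕ} {X : Type u} [TopologicalSpace X] [T2Space X] [CompactSpace X]
    (r : ℕ∞) (hr : 1 ≤ r) (O : Orbifold.{u, v} n (r + 1) X) (𝒞 : O.Cover) :
    letI : TopologicalSpace O.Orbisection := 𝒞.crTopology
    (r < ⊤ → IsSeparableBanachSpace O.Orbisection) ∧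
    (r = ⊤ → IsSeparableFrechetSpace O.Orbisection) ∧
    ∃ (N : ℕ) (i : Fin N → O.ι) (ρ : Fin N → ℝ)
      (T : O.Orbisection →ₗ[ℝ] (a : Fin N) →
        CrSpace (EuclideanSpace ℝ (Fin n)) r
          (Metric.closedBall (0 : EuclideanSpace ℝ (Fin n)) (ρ a))),
      (∀ a, 0 < ρ a ∧ Metric.closedBall 0 (ρ a) ⊆ (O.chart (i a)).source) ∧
      (⋃ a, (O.chart (i a)).proj '' Metric.ball 0 (ρ a)) = Set.univ ∧
      (∀ σ a, ∀ y ∈ Metric.closedBall 0 (ρ a), (T σ a).val y = σ.field (i a) y) ∧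
      Topology.IsClosedEmbedding T := by
  let _ : TopologicalSpace O.Orbisection := 𝒞.crTopology
  obtain ⟨N, i, ρ, hρ, hcov⟩ := O.exists_finite_cover_balls
  have hKs := fun a => (hρ a).2
  have hK : ⋃ a, (O.chart (i a)).proj '' Metric.closedBall 0 (ρ a) = univ :=
    univ_subset_iff.1 (hcov.symm.subset.trans
      (iUnion_mono fun a => image_mono Metric.ball_subset_closedBall))
  have : ∀ a, CompactSpace (Metric.closedBall (0 : EuclideanSpace ℝ (Fin n)) (ρ a)) := fun a =>
    isCompact_iff_compactSpace.1 (isCompact_closedBall _ _)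
  refine ⟨Orbifold.Orbisection.isSeparableBanachSpace 𝒞 hKs hK,
    fun _ => Orbifold.Orbisection.isSeparableFrechetSpace 𝒞 hKs hK,
    N, i, ρ, Orbifold.Orbisection.restrict hKs, hρ, hcov,
    fun σ a y hy => Orbifold.Orbisection.restrict_val hKs σ a hy,
    Orbifold.Orbisection.isClosedEmbedding_restrict 𝒞 hKs hK fun a => ?_⟩
  -- Positivity of the radius gives the closed ball nonempty interior; a convex set with this
  -- property has unique derivatives, also at the boundary.
  · refine uniqueDiffOn_convex (convex_closedBall _ _) ⟨0, ?_⟩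
    exact Metric.ball_subset_interior_closedBall (Metric.mem_ball_self (hρ a).1)
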